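/- Let $L\subset\mathbb R^2$ be a lattice and let $\mathcal D$ be a hyperbolic automorphism of the torus $\mathbb T^2=\mathbb R^2/L$, in coordinates in which the stable direction is horizontal and the unstable direction is vertical: $\mathcal D$ is induced by $\mathrm{diag}(\mu,\lambda)$ with $|\lambda|>1$, $|\mu|=1/|\lambda|$, which maps $L$ onto itself. A bi-partition of $\mathbb T^2$ is, up to translation, the pair $R_1=[0,u]\times[0,p]$, $R_2=[-v,0]\times[0,q]$ with $u,v,p,q>0$ such that $[v,p]$ and $[-u,q]$ generate $L$; its horizontal spine $J^s$ and vertical spine $J^u$ are the unions, in $\mathbb T^2$, of the horizontal, respectively vertical, sides of $R_1,R_2$. It is a Berg partition of $\mathcal D$ if $\mathcal D(J^s)\subset J^s$ and $\mathcal D(J^u)\supset J^u$. For either ordering of the two rectangles, the entry $c_{ij}$ of its connectivity matrix is the number of translates of $R_j$ by vectors of $L$ whose interior meets the interior of the image of $R_i$ under $\mathrm{diag}(\mu,\lambda)$. Two bi-partitions are equivalent if some homeomorphism of $\mathbb T^2$ commuting with $\mathcal D$ takes one into the other, without regard to the ordering of the rectangles. (1) If $\{R_1,R_2\}$ and $\{R_1',R_2'\}$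 are two Berg partitions of $\mathcal D$ with the same connectivity matrix (for some orderings of the rectangles), then there is a translation $\mathcal T$ of $\mathbb T^2$ such that $\{\mathcal T(R_1),\mathcal T(R_2)\}$ is a Berg partition equivalent to $\{R'_1,R'_2\}$. (2) Let $\mathcal F$ be the set of bases $\{e,f\}$ of $L$ with $e$ in the open first and $f$ in the open second quadrant. Then $\mathcal F$ is non-empty. Given $\{e_0,f_0\}\in\mathcal F$, let $\{e_n,f_n\}_{n\in\mathbb Z}$ be the sequence of bases obtained from it by the cutting algorithm: $(e_{n+1},f_{n+1})=(e_n+f_n,f_n)$ and $s_n=1$ if $e_n+f_n$ is in the right half-plane, and $(e_{n+1},f_{n+1})=(e_n,e_n+f_n)$ and $s_n=0$ otherwise, and backwards, $(e_{n-1},f_{n-1})=(e_n-f_n,f_n)$ if $e_n-f_n$ is in the upper half-plane and $(e_n,f_n-e_n)$ otherwise. Then the cutting sequence $(s_n)_{n\in\mathbb Z}$ has a basic (semi-)period $N$: the smallest $N\ge1$ with $s_{k+N}=1-s_k$ for all $k$ or, if there is none, the smallest $N\ge1$ with $s_{k+N}=s_k$ for all $k$. There are exactly $N$ shapes of Berg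 partitions of $\mathcal D$, where two Berg partitions have the same shape if a translate of the first is equivalent to the second: there are $N$ Berg partitions such that every Berg partition of $\mathcal D$ has the same shape as exactly one of them. -/

import Mathlib

open Set

noncomputable section

/-- The plane, with its horizontal (first) and vertical (second) coordinate. -/
abbrev Plane : Type := ℝ × ℝ

/-- A hyperbolic toral automorphism of `ℝ² / L`, in the coordinates in which the stable direction
is the horizontal axis and the unstable direction is the vertical axis: it is induced by
`diag(μ, λ)` with `|λ| > 1` and `|μ| = 1 / |λ|`, which maps the lattice `L` onto itself. -/
structure HyperbolicToralAut (L : Submodule ℤ Plane) where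
  mu : ℝ
  lam : ℝ
  one_lt_abs_lam : 1 < |lam|
  abs_mu : |mu| = 1 / |lam|
  map_mem_iff : ∀ z : Plane, (mu * z.1, lam * z.2) ∈ L ↔ z ∈ L

namespace HyperbolicToralAut

variable {L : Submodule ℤ Plane}

/-- The linear map `diag(μ, λ)` of the plane. -/
def planeMap (D : HyperbolicToralAut L) : Plane →ₗ[ℤ] Plane where
  toFun z := (D.mu * z.1, D.lam * z.2)
  map_add' z w := by ext <;> simp [mul_add]
  map_smul' a z := by ext <;> simp [mul_left_comm]

/-- The induced map of the torus `ℝ² / L`. -/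
def torusMap (D : HyperbolicToralAut L) : (Plane ⧸ L) →ₗ[ℤ] (Plane ⧸ L) :=
  L.mapQ L D.planeMap (fun z hz => (D.map_mem_iff z).2 hz)

end HyperbolicToralAut

/-- A bi-partition of the torus `ℝ² / L`: two adjacent rectangles with bases on a common
horizontal line and a common corner `w`, the `u × p` rectangle `R₁` lying to the right and the
`v × q` rectangle `R₂` to the left of the vertical line through `w`, where `[v, p]`, `[-u, q]`
generate the lattice `L`. -/
structure BiPartition (L : Submodule ℤ Plane) where
  u : ℝ
  v : ℝ
  p : ℝ
  q : ℝ
  w : Plane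
  u_pos : 0 < u
  v_pos : 0 < v
  p_pos : 0 < p
  q_pos : 0 < q
  span_eq : Submodule.span ℤ {((v, p) : Plane), ((-u, q) : Plane)} = L

namespace BiPartition

variable {L : Submodule ℤ Plane}

/-- Abscissa of the left side of each of the two rectangles. -/
def left (P : BiPartition L) : Fin 2 → ℝ := ![P.w.1, P.w.1 - P.v]

/-- Abscissa of the right side. -/
def right (P : BiPartition L) : Fin 2 → ℝ := ![P.w.1 + P.u, P.w.1]

/-- Ordinate of the bottom side. -/
def bottom (P : BiPartition L) : Fin 2 → ℝ := ![P.w.2, P.w.2]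

/-- Ordinate of the top side. -/
def top (P : BiPartition L) : Fin 2 → ℝ := ![P.w.2 + P.p, P.w.2 + P.q]

/-- The two (closed) rectangles in the plane. -/
def rect (P : BiPartition L) (i : Fin 2) : Set Plane :=
  Icc (P.left i) (P.right i) ×ˢ Icc (P.bottom i) (P.top i)

/-- The open rectangles, projected to the torus. The elements of the partition are recorded by
their open rectangles (whose closures are the projections of the closed rectangles), because the
projection of a closed connected rectangle touches itself along a part of its boundary. -/
def tile (P : BiPartition L) (i : Fin 2) : Set (Plane ⧸ L) :=
  L.mkQ '' interior (P.rect i)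

/-- The horizontal spine `Jˢ`: the union of the horizontal sides, in the torus. -/
def horizontalSpine (P : BiPartition L) : Set (Plane ⧸ L) :=
  L.mkQ '' ⋃ i : Fin 2, Icc (P.left i) (P.right i) ×ˢ {P.bottom i, P.top i}

/-- The vertical spine `Jᵘ`: the union of the vertical sides, in the torus. -/
def verticalSpine (P : BiPartition L) : Set (Plane ⧸ L) :=
  L.mkQ '' ⋃ i : Fin 2, {P.left i, P.right i} ×ˢ Icc (P.bottom i) (P.top i)

/-- The image of a bi-partition under the translation of the torus induced by `t`. -/
def translate (P : BiPartition L) (t : Plane) : BiPartition L where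
  u := P.u
  v := P.v
  p := P.p
  q := P.q
  w := P.w + t
  u_pos := P.u_pos
  v_pos := P.v_pos
  p_pos := P.p_pos
  q_pos := P.q_pos
  span_eq := P.span_eq

end BiPartition

namespace HyperbolicToralAut

variable {L : Submodule ℤ Plane}

/-- Berg partitions of `D`. -/
def IsBerg (D : HyperbolicToralAut L) (P : BiPartition L) : Prop :=
  D.torusMap '' P.horizontalSpine ⊆ P.horizontalSpine ∧
    P.verticalSpine ⊆ D.torusMap '' P.verticalSpine

/-- The connectivity matrix, for the ordering `R (σ 0), R (σ 1)` of the two rectangles: the entry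
`(i, j)` is the number of translates of the `j`-th rectangle, by vectors of `L`, whose interior is
intersected by the interior of the image of the `i`-th rectangle. -/
def connectivityMatrix (D : HyperbolicToralAut L) (P : BiPartition L)
    (σ : Equiv.Perm (Fin 2)) : Matrix (Fin 2) (Fin 2) ℕ :=
  Matrix.of fun i j => Set.ncard
    {l : Plane | l ∈ L ∧
      ((D.planeMap '' interior (P.rect (σ i))) ∩
        ((fun z => z + l) '' interior (P.rect (σ j)))).Nonempty}

/-- Two bi-partitions have the same connectivity matrix, for some orderings of their rectangles. -/
def SameConnectivity (D : HyperbolicToralAut L) (P Q : BiPartition L) : Prop :=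
  ∃ σ τ : Equiv.Perm (Fin 2), D.connectivityMatrix P σ = D.connectivityMatrix Q τ

/-- Equivalence of partitions: some homeomorphism of the torus that commutes with `D` takes the
one into the other, without regard to the ordering of the rectangles. -/
def Equivalent (D : HyperbolicToralAut L) (P Q : BiPartition L) : Prop :=
  ∃ h : (Plane ⧸ L) ≃ₜ (Plane ⧸ L), (∀ x, h (D.torusMap x) = D.torusMap (h x)) ∧
    ∃ σ : Equiv.Perm (Fin 2), ∀ i, h '' P.tile i = Q.tile (σ i)

/-- Two partitions have the same shape: a translate of the first is equivalent to the second. -/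
def SameShape (D : HyperbolicToralAut L) (P Q : BiPartition L) : Prop :=
  ∃ t : Plane, D.Equivalent (P.translate t) Q

end HyperbolicToralAut

/-- The bi-fan of `L`: bases `(e, f)` of `L` with `e` in the open first and `f` in the open second
quadrant. -/
def biFan (L : Submodule ℤ Plane) : Set (Plane × Plane) :=
  {b | 0 < b.1.1 ∧ 0 < b.1.2 ∧ b.2.1 < 0 ∧ 0 < b.2.2 ∧ Submodule.span ℤ {b.1, b.2} = L}

/-- One step of the cutting algorithm: `(e, f)` becomes `(e + f, f)` if `e + f` is in the right
half-plane and `(e, e + f)` otherwise. -/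
def cutForward (b : Plane × Plane) : Plane × Plane :=
  open Classical in
  if 0 < (b.1 + b.2).1 then (b.1 + b.2, b.2) else (b.1, b.1 + b.2)

/-- One step of the algorithm backwards: `(e, f)` becomes `(e - f, f)` if `e - f` is in the upper
half-plane and `(e, f - e)` otherwise. -/
def cutBackward (b : Plane × Plane) : Plane × Plane :=
  open Classical in
  if 0 < (b.1 - b.2).2 then (b.1 - b.2, b.2) else (b.1, b.2 - b.1)

/-- The bi-infinite sequence of bases `(eₙ, fₙ)` that the cutting algorithm produces from
`(e₀, f₀) = b`. -/
def cutBasis (b : Plane × Plane) : ℤ → Plane × Plane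
  | Int.ofNat n => cutForward^[n] b
  | Int.negSucc n => cutBackward^[n + 1] b

/-- The cutting sequence: `sₙ = 1` if `fₙ₊₁ = fₙ`, and `sₙ = 0` otherwise, i.e. if
`eₙ₊₁ = eₙ`. -/
def cuttingSeq (b : Plane × Plane) (n : ℤ) : ℤ :=
  open Classical in
  if (cutBasis b (n + 1)).2 = (cutBasis b n).2 then 1 else 0

/-- `N` is a period of `s`. -/
def IsPeriod (s : ℤ → ℤ) (N : ℕ) : Prop := 0 < N ∧ ∀ k : ℤ, s (k + N) = s k

/-- `N` is a semi-period of the 0-1 sequence `s`. -/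
def IsSemiPeriod (s : ℤ → ℤ) (N : ℕ) : Prop := 0 < N ∧ ∀ k : ℤ, s (k + N) = 1 - s k

/-- `N` is the basic (semi-)period of `s`: its smallest semi-period or, if there is no semi-period,
its smallest period. -/
def IsBasicSemiPeriodOrPeriod (s : ℤ → ℤ) (N : ℕ) : Prop :=
  IsLeast {M | IsSemiPeriod s M} N ∨
    ((¬ ∃ M, IsSemiPeriod s M) ∧ IsLeast {M | IsPeriod s M} N)

end

/-! Up to translation a bi-partition is the same thing as a basis of the bi-fan, namely
`BiPartition.basis` = `([v, p], [-u, q])`. The theorem is proved by translating every notion about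
Berg partitions into one about these bases.

Equivalence. A homeomorphism of the torus that commutes with `D` lifts to an affine map of the plane
with diagonal linear part (`exists_affine_of_commute`): the defect of the lift from being affine is
a bounded periodic function multiplied by a factor greater than 1 in absolute value, hence zero.
Such a map scales the widths and heights of the rectangles, so having the same shape amounts to
`DiagRel`, the existence of a diagonal map between the two bases, possibly exchanging `e` and `f`
(`diagRel_of_equivalent`, `exists_equivalent_of_diagRel`).

Connectivity. In a Berg partition the image of a rectangle is a union of full vertical crossings.
Hence the heights form an eigenvector of the connectivity matrix for `|λ|` (`abs_lam_mul_height`),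
and since `|λ|` is not an integer the matrix determines their ratio. A lattice vector is determined
by its height, so the ratio of the heights determines the basis up to a diagonal map; this gives (1)
through `diagRel_of_sameConnectivity`.

Counting. The bi-fan is a single orbit of the cutting algorithm (`exists_cutBasis_eq`), and every
basis in it carries a Berg partition (`exists_isBerg`). Diagonal maps commute with the algorithm,
with a reflection complementing the cutting sequence; conversely a coincidence of the sequence with
a shift of itself or of its complement produces a diagonal map (`diagRel_cutBasis_iff`). Shapes are
therefore the cosets in `ℤ` of the group `shiftGroup`, whose positive generator is the basic
(semi-)period `N`. -/

noncomputable section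

/-! ### Lattices without vectors on the axes -/

/-- No nonzero vector of `L` lies on a coordinate axis. -/
def AxisFree (L : Submodule ℤ Plane) : Prop :=
  (∀ l ∈ L, l.1 = 0 → l = 0) ∧ ∀ l ∈ L, l.2 = 0 → l = 0

lemma Plane.mem_span_pair {a b z : Plane} : z ∈ Submodule.span ℤ {a, b} ↔
    ∃ m n : ℤ, z.1 = m * a.1 + n * b.1 ∧ z.2 = m * a.2 + n * b.2 := by
  rw [Submodule.mem_span_pair]
  refine exists_congr fun m => exists_congr fun n => ?_
  rw [Prod.ext_iff, Prod.fst_add, Prod.snd_add, Prod.smul_fst, Prod.smul_fst, Prod.smul_snd,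
    Prod.smul_snd, zsmul_eq_mul, zsmul_eq_mul, zsmul_eq_mul, zsmul_eq_mul, eq_comm,
    eq_comm (b := z.2)]

lemma span_pair_congr {a b c d : Plane} (hc : c ∈ Submodule.span ℤ {a, b})
    (hd : d ∈ Submodule.span ℤ {a, b}) (ha : a ∈ Submodule.span ℤ {c, d})
    (hb : b ∈ Submodule.span ℤ {c, d}) : Submodule.span ℤ {c, d} = Submodule.span ℤ {a, b} := by
  apply le_antisymm <;> rw [Submodule.span_le] <;> rintro x (rfl | rfl) <;> assumption

lemma span_sub_left (a b : Plane) : Submodule.span ℤ {a - b, b} = Submodule.span ℤ {a, b} :=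
  span_pair_congr (Submodule.mem_span_pair.2 ⟨1, -1, by module⟩)
    (Submodule.mem_span_pair.2 ⟨0, 1, by module⟩) (Submodule.mem_span_pair.2 ⟨1, 1, by module⟩)
    (Submodule.mem_span_pair.2 ⟨0, 1, by module⟩)

lemma span_sub_right (a b : Plane) : Submodule.span ℤ {a, b - a} = Submodule.span ℤ {a, b} := by
  rw [Set.pair_comm, span_sub_left, Set.pair_comm]

lemma span_neg_left (a b : Plane) : Submodule.span ℤ {-a, b} = Submodule.span ℤ {a, b} :=
  span_pair_congr (Submodule.mem_span_pair.2 ⟨-1, 0, by module⟩)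
    (Submodule.mem_span_pair.2 ⟨0, 1, by module⟩) (Submodule.mem_span_pair.2 ⟨-1, 0, by module⟩)
    (Submodule.mem_span_pair.2 ⟨0, 1, by module⟩)

lemma span_neg_right (a b : Plane) : Submodule.span ℤ {a, -b} = Submodule.span ℤ {a, b} := by
  rw [Set.pair_comm, span_neg_left, Set.pair_comm]

namespace HyperbolicToralAut

variable {L : Submodule ℤ Plane}

lemma lam_ne_zero (D : HyperbolicToralAut L) : D.lam ≠ 0 := by
  intro h
  have := D.one_lt_abs_lam
  simp [h] at this
  linarith

lemma mu_ne_zero (D : HyperbolicToralAut L) : D.mu ≠ 0 := by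
  intro h
  have := D.abs_mu
  have h2 := D.lam_ne_zero
  rw [h, abs_zero, eq_comm, one_div, inv_eq_zero] at this
  exact h2 (abs_eq_zero.1 this)

lemma abs_mu_pos (D : HyperbolicToralAut L) : 0 < |D.mu| := abs_pos.2 D.mu_ne_zero

lemma abs_mu_mul_abs_lam (D : HyperbolicToralAut L) : |D.mu| * |D.lam| = 1 := by
  have h2 := abs_pos.2 D.lam_ne_zero
  rw [D.abs_mu]
  field_simp

lemma abs_mu_lt_one (D : HyperbolicToralAut L) : |D.mu| < 1 := by
  have h1 := D.one_lt_abs_lam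
  have h2 := D.abs_mu_mul_abs_lam
  have h3 := D.abs_mu_pos
  nlinarith

lemma mu_ne_lam (D : HyperbolicToralAut L) : D.mu ≠ D.lam := by
  intro h
  have := D.abs_mu_lt_one
  have := D.one_lt_abs_lam
  rw [h] at *
  linarith

lemma planeMap_apply (D : HyperbolicToralAut L) (z : Plane) :
    D.planeMap z = (D.mu * z.1, D.lam * z.2) := rfl

lemma planeMap_mem_iff (D : HyperbolicToralAut L) (z : Plane) : D.planeMap z ∈ L ↔ z ∈ L :=
  D.map_mem_iff z

lemma torusMap_mkQ (D : HyperbolicToralAut L) (z : Plane) :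
    D.torusMap (L.mkQ z) = L.mkQ (D.planeMap z) := rfl

/-- Powers of `D` contract the horizontal axis and powers of its inverse contract the vertical one,
so a nonzero lattice vector on an axis would have nonzero lattice vectors arbitrarily close to 0. -/
lemma axisFree [DiscreteTopology L] (D : HyperbolicToralAut L) : AxisFree L := by
  obtain ⟨ε, hε, hball⟩ : ∃ ε > 0, ∀ l ∈ L, ‖l‖ < ε → l = 0 := by
    have h := (Metric.isOpen_iff.1 (isOpen_discrete ({0} : Set L))) 0 rfl
    obtain ⟨ε, hε, h⟩ := h
    refine ⟨ε, hε, fun l hl hn => ?_⟩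
    have : (⟨l, hl⟩ : L) ∈ ({0} : Set L) := h (by
      rw [Metric.mem_ball, dist_zero_right]; exact hn)
    simpa using this
  have key : ∀ r : ℝ, |r| < 1 → ∀ x : ℝ, ∃ n : ℕ, |r ^ n * x| < ε := by
    intro r hr x
    have h := (tendsto_pow_atTop_nhds_zero_of_abs_lt_one hr).mul_const x
    rw [zero_mul] at h
    obtain ⟨n, hn⟩ := ((Metric.tendsto_nhds.1 h) ε hε).exists
    exact ⟨n, by simpa [Real.dist_eq] using hn⟩
  constructor
  · rintro ⟨x, y⟩ hl (rfl : x = 0)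
    have hpow : ∀ n : ℕ, ((0 : ℝ), (D.lam⁻¹) ^ n * y) ∈ L := by
      intro n
      induction n with
      | zero => simpa using hl
      | succ n ih =>
        rw [← D.map_mem_iff]
        convert ih using 2
        · simp
        · have := D.lam_ne_zero
          simp only
          rw [pow_succ]
          field_simp
    obtain ⟨n, hn⟩ := key D.lam⁻¹ (by
      rw [abs_inv]; exact inv_lt_one_of_one_lt₀ D.one_lt_abs_lam) y
    have := hball _ (hpow n) (by
      rw [Prod.norm_def]; exact max_lt (by simpa using hε) hn)
    have := D.lam_ne_zero
    simp_all
  · rintro ⟨x, y⟩ hl (rfl : y = 0)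
    have hpow : ∀ n : ℕ, (D.mu ^ n * x, (0 : ℝ)) ∈ L := by
      intro n
      induction n with
      | zero => simpa using hl
      | succ n ih =>
        rw [← D.map_mem_iff] at ih
        convert ih using 2
        · simp only
          ring
        · simp
    obtain ⟨n, hn⟩ := key D.mu D.abs_mu_lt_one x
    have := hball _ (hpow n) (by
      rw [Prod.norm_def]; exact max_lt hn (by simpa using hε))
    have := D.mu_ne_zero
    simp_all

/-- If one vector generated `L`, it would be an eigenvector of `diag(μ, λ)` with both coordinates
nonzero, forcing `μ = λ`. -/
lemma span_self_ne (D : HyperbolicToralAut L) (hL : AxisFree L) {a : Plane} (ha : a ≠ 0) :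
    Submodule.span ℤ {a, a} ≠ L := by
  intro h
  have haL : a ∈ L := h ▸ Submodule.subset_span (by simp)
  have hD : D.planeMap a ∈ L := (D.planeMap_mem_iff a).2 haL
  obtain ⟨m, n, h1, h2⟩ := Plane.mem_span_pair.1 (h.ge hD)
  simp only [planeMap_apply] at h1 h2
  have ha1 : a.1 ≠ 0 := fun h => ha (hL.1 a haL h)
  have ha2 : a.2 ≠ 0 := fun h => ha (hL.2 a haL h)
  apply D.mu_ne_lam
  apply mul_right_cancel₀ (mul_ne_zero ha1 ha2)
  linear_combination a.2 * h1 - a.1 * h2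

end HyperbolicToralAut

/-! ### The bi-fan is non-empty -/

section BiFan

variable {L : Submodule ℤ Plane}

lemma biFan_nonempty_of_mul_neg {a c : Plane} (h1 : a.1 * c.1 < 0) (ha : 0 < a.2) (hc : 0 < c.2)
    (h : Submodule.span ℤ {a, c} = L) : (biFan L).Nonempty := by
  rcases mul_neg_iff.1 h1 with ⟨h1, h2⟩ | ⟨h1, h2⟩
  · exact ⟨(a, c), h1, ha, h2, hc, h⟩
  · exact ⟨(c, a), h2, hc, h1, ha, by rw [Set.pair_comm]; exact h⟩

/-- A Euclidean algorithm for two basis vectors in the same upper quadrant (`s` is the sign of their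
abscissas). If one vector exceeds the other in both coordinates, subtracting reduces the total
ℓ¹-size by the size of the smaller one, hence by at least `ε`, so `n` bounds the number of steps.
Otherwise the difference, suitably signed, lies in the other upper quadrant and completes a basis of
the bi-fan. -/
lemma biFan_nonempty_of_descent (D : HyperbolicToralAut L) (hL : AxisFree L) {ε : ℝ}
    (hε : ∀ l ∈ L, l ≠ 0 → ε ≤ |l.1| + |l.2|) {s : ℝ} (n : ℕ) :
    ∀ a b : Plane, 0 < s * a.1 → 0 < a.2 → 0 < s * b.1 → 0 < b.2 →
      Submodule.span ℤ {a, b} = L → |a.1| + |a.2| + |b.1| + |b.2| < n * ε → (s = 1 ∨ s = -1) →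
      (biFan L).Nonempty := by
  induction n with
  | zero =>
    intro a b _ _ _ _ _ h _
    have := abs_nonneg a.1
    have := abs_nonneg a.2
    have := abs_nonneg b.1
    have := abs_nonneg b.2
    simp only [CharP.cast_eq_zero, zero_mul] at h
    linarith
  | succ n ih =>
    intro a b ha1 ha2 hb1 hb2 hspan hlt hs
    have ha0 : a ≠ 0 := by rintro rfl; simp at ha2
    have hb0 : b ≠ 0 := by rintro rfl; simp at hb2
    have haL : a ∈ L := hspan ▸ Submodule.subset_span (by simp)
    have hbL : b ∈ L := hspan ▸ Submodule.subset_span (by simp)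
    have hc0 : a - b ≠ 0 := fun h => by
      rw [sub_eq_zero.1 h] at hspan
      exact D.span_self_ne hL hb0 hspan
    have hc1 : a.1 - b.1 ≠ 0 := fun h => hc0 (hL.1 _ (L.sub_mem haL hbL) h)
    have hc2 : a.2 - b.2 ≠ 0 := fun h => hc0 (hL.2 _ (L.sub_mem haL hbL) h)
    have hs2 : s * s = 1 := by rcases hs with rfl | rfl <;> norm_num
    have habs : ∀ x : ℝ, 0 < s * x → |x| = s * x := by
      intro x hx
      rcases hs with rfl | rfl
      · rw [one_mul] at *; exact abs_of_pos hx
      · rw [abs_of_neg (by linarith)]; ring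
    have hea := hε a haL ha0
    have heb := hε b hbL hb0
    push_cast at hlt
    rw [habs _ ha1, habs _ hb1, abs_of_pos ha2, abs_of_pos hb2] at hlt
    rw [habs _ ha1, abs_of_pos ha2] at hea
    rw [habs _ hb1, abs_of_pos hb2] at heb
    have hsc : s * (a.1 - b.1) ≠ 0 := mul_ne_zero (by rintro rfl; simp at hs2) hc1
    rcases lt_or_gt_of_ne hsc with h1 | h1 <;> rcases lt_or_gt_of_ne hc2 with h2 | h2
    · refine ih a (b - a) ha1 ha2 (by simp only [Prod.fst_sub]; linarith)
        (by simp only [Prod.snd_sub]; linarith) (by rw [span_sub_right, hspan]) ?_ hs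
      rw [Prod.fst_sub, Prod.snd_sub, habs _ ha1, habs (b.1 - a.1) (by linarith), abs_of_pos ha2,
        abs_of_pos (by linarith)]
      linarith
    · refine biFan_nonempty_of_mul_neg (a := a - b) (c := b) ?_ h2 hb2 (by rw [span_sub_left, hspan])
      have := mul_neg_of_neg_of_pos h1 hb1
      simp only [Prod.fst_sub]
      nlinarith
    · refine biFan_nonempty_of_mul_neg (a := a) (c := b - a) ?_ ha2
        (by simp only [Prod.snd_sub]; linarith) (by rw [span_sub_right, hspan])
      have := mul_pos h1 ha1
      simp only [Prod.fst_sub]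
      nlinarith
    · refine ih (a - b) b h1 h2 hb1 hb2 (by rw [span_sub_left, hspan]) ?_ hs
      rw [Prod.fst_sub, Prod.snd_sub, habs _ hb1, habs _ h1, abs_of_pos hb2, abs_of_pos h2]
      linarith

theorem biFan_nonempty [DiscreteTopology L] [IsZLattice ℝ L] (D : HyperbolicToralAut L) :
    (biFan L).Nonempty := by
  have hL := D.axisFree
  obtain ⟨ε, hε, hball⟩ : ∃ ε > 0, ∀ l ∈ L, l ≠ 0 → ε ≤ |l.1| + |l.2| := by
    have h := (Metric.isOpen_iff.1 (isOpen_discrete ({0} : Set L))) 0 rfl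
    obtain ⟨ε, hε, h⟩ := h
    refine ⟨ε, hε, fun l hl hn => ?_⟩
    by_contra! hlt
    have : (⟨l, hl⟩ : L) ∈ ({0} : Set L) := h (by
      rw [Metric.mem_ball, dist_zero_right]
      change ‖l‖ < ε
      rw [Prod.norm_def, Real.norm_eq_abs, Real.norm_eq_abs]
      have := abs_nonneg l.1
      have := abs_nonneg l.2
      exact max_lt (by linarith) (by linarith))
    exact hn (by simpa using this)
  have := ZLattice.module_free ℝ L
  have := ZLattice.module_finite ℝ L
  have hrank : Module.finrank ℤ L = 2 := by rw [ZLattice.rank ℝ L]; simp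
  let B := Module.finBasisOfFinrankEq ℤ L hrank
  have hspan : Submodule.span ℤ {(B 0 : Plane), (B 1 : Plane)} = L := by
    have h1 := congrArg (Submodule.map L.subtype) B.span_eq
    rw [Submodule.map_span, Submodule.map_top, Submodule.range_subtype, ← Set.range_comp] at h1
    convert h1 using 2
    ext x
    simp [Fin.exists_fin_two, eq_comm]
  obtain ⟨a, b, ha, hb, hab⟩ : ∃ a b : Plane, 0 < a.2 ∧ 0 < b.2 ∧ Submodule.span ℤ {a, b} = L := by
    have h0 : ∀ i, (B i : Plane).2 ≠ 0 := fun i h =>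
      B.ne_zero i (by simpa using hL.2 _ (B i).2 h)
    rcases lt_or_gt_of_ne (h0 0) with h | h <;> rcases lt_or_gt_of_ne (h0 1) with h' | h'
    · exact ⟨-(B 0 : Plane), -(B 1 : Plane), neg_pos.2 h, neg_pos.2 h', by
        rw [span_neg_left, span_neg_right, hspan]⟩
    · exact ⟨-(B 0 : Plane), _, neg_pos.2 h, h', by rw [span_neg_left, hspan]⟩
    · exact ⟨_, -(B 1 : Plane), h, neg_pos.2 h', by rw [span_neg_right, hspan]⟩
    · exact ⟨_, _, h, h', hspan⟩
  have ha1 : a.1 ≠ 0 := fun h => by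
    have := hL.1 a (hab ▸ Submodule.subset_span (by simp)) h
    simp [this] at ha
  have hb1 : b.1 ≠ 0 := fun h => by
    have := hL.1 b (hab ▸ Submodule.subset_span (by simp)) h
    simp [this] at hb
  obtain ⟨n, hn⟩ := exists_nat_gt ((|a.1| + |a.2| + |b.1| + |b.2|) / ε)
  rw [div_lt_iff₀ hε] at hn
  rcases lt_or_gt_of_ne ha1 with h | h <;> rcases lt_or_gt_of_ne hb1 with h' | h'
  · exact biFan_nonempty_of_descent D hL hball (s := -1) n a b (by linarith) ha (by linarith) hb hab
      hn (Or.inr rfl)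
  · exact biFan_nonempty_of_mul_neg (mul_neg_of_neg_of_pos h h') ha hb hab
  · exact biFan_nonempty_of_mul_neg (mul_neg_of_pos_of_neg h h') ha hb hab
  · exact biFan_nonempty_of_descent D hL hball (s := 1) n a b (by linarith) ha (by linarith) hb hab
      hn (Or.inl rfl)

end BiFan

/-! ### Homeomorphisms commuting with a hyperbolic automorphism are affine -/

section Affine

variable {L : Submodule ℤ Plane}

lemma biFan_fst_mem {b : Plane × Plane} (hb : b ∈ biFan L) : b.1 ∈ L :=
  hb.2.2.2.2 ▸ Submodule.subset_span (by simp)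

lemma biFan_snd_mem {b : Plane × Plane} (hb : b ∈ biFan L) : b.2 ∈ L :=
  hb.2.2.2.2 ▸ Submodule.subset_span (by simp)

lemma mem_iff_of_biFan {b : Plane × Plane} (hb : b ∈ biFan L) {z : Plane} :
    z ∈ L ↔ ∃ m n : ℤ, z.1 = m * b.1.1 + n * b.2.1 ∧ z.2 = m * b.1.2 + n * b.2.2 := by
  rw [← Plane.mem_span_pair, hb.2.2.2.2]

lemma biFan_det_pos {b : Plane × Plane} (hb : b ∈ biFan L) :
    0 < b.1.1 * b.2.2 - b.1.2 * b.2.1 := by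
  obtain ⟨h1, h2, h3, h4, -⟩ := hb
  have := mul_pos h1 h4
  have := mul_pos h2 (neg_pos.2 h3)
  linarith

/-- The coefficient `n` is nonzero because `b.1`, having no zero coordinate, is not an eigenvector.
-/
lemma HyperbolicToralAut.exists_coeff (D : HyperbolicToralAut L) {b : Plane × Plane}
    (hb : b ∈ biFan L) : ∃ m n : ℤ, (n : ℝ) ≠ 0 ∧ D.mu * b.1.1 = m * b.1.1 + n * b.2.1 ∧
      D.lam * b.1.2 = m * b.1.2 + n * b.2.2 := by
  obtain ⟨m, n, h1, h2⟩ := (mem_iff_of_biFan hb).1 ((D.planeMap_mem_iff b.1).2 (biFan_fst_mem hb))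
  simp only [D.planeMap_apply] at h1 h2
  refine ⟨m, n, ?_, h1, h2⟩
  intro hn
  rw [hn, zero_mul, add_zero] at h1 h2
  exact D.mu_ne_lam ((mul_right_cancel₀ hb.1.ne' h1).trans (mul_right_cancel₀ hb.2.1.ne' h2).symm)

lemma isCoveringMap_mkQ [DiscreteTopology L] : IsCoveringMap L.mkQ :=
  (AddSubgroup.isAddQuotientCoveringMap_of_comm L.toAddSubgroup ⟨‹_›⟩).isCoveringMap

lemma mkQ_eq_iff {z w : Plane} : L.mkQ z = L.mkQ w ↔ z - w ∈ L := Submodule.Quotient.eq L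

lemma exists_eq_const_of_forall_mem [DiscreteTopology L] {f : Plane → Plane} (hf : Continuous f)
    (hL : ∀ z, f z ∈ L) (z w : Plane) : f z = f w := by
  have h : Continuous fun z => (⟨f z, hL z⟩ : L) := hf.subtype_mk hL
  exact congrArg Subtype.val (PreconnectedSpace.constant inferInstance h (x := z) (y := w))

/-- A continuous periodic function attains the maximum of its absolute value. -/
lemma exists_abs_le_of_periodic {b : Plane × Plane} (hb : b ∈ biFan L) {g : Plane → ℝ}
    (hg : Continuous g) (hper : ∀ l ∈ L, ∀ z, g (z + l) = g z) : ∃ z₀, ∀ z, |g z| ≤ |g z₀| := by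
  let φ : ℝ × ℝ → Plane := fun r =>
    (r.1 * b.1.1 + r.2 * b.2.1, r.1 * b.1.2 + r.2 * b.2.2)
  have hφ : Continuous φ := by fun_prop
  have hK : IsCompact (Icc (0 : ℝ) 1 ×ˢ Icc (0 : ℝ) 1) := isCompact_Icc.prod isCompact_Icc
  obtain ⟨r, -, hr⟩ := hK.exists_isMaxOn (f := fun r => |g (φ r)|) ⟨(0, 0), by simp⟩
    (by fun_prop)
  refine ⟨φ r, fun z => ?_⟩
  have hdet := (biFan_det_pos hb).ne'
  set d := b.1.1 * b.2.2 - b.1.2 * b.2.1 with hd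
  set x := (b.2.2 * z.1 - b.2.1 * z.2) / d with hx
  set y := (b.1.1 * z.2 - b.1.2 * z.1) / d with hy
  have hl : ((⌊x⌋ * b.1.1 + ⌊y⌋ * b.2.1, ⌊x⌋ * b.1.2 + ⌊y⌋ * b.2.2) : Plane) ∈ L :=
    (mem_iff_of_biFan hb).2 ⟨⌊x⌋, ⌊y⌋, rfl, rfl⟩
  have hz : z = φ (Int.fract x, Int.fract y) +
      (⌊x⌋ * b.1.1 + ⌊y⌋ * b.2.1, ⌊x⌋ * b.1.2 + ⌊y⌋ * b.2.2) := by
    have hx' : x * d = b.2.2 * z.1 - b.2.1 * z.2 := div_mul_cancel₀ _ hdet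
    have hy' : y * d = b.1.1 * z.2 - b.1.2 * z.1 := div_mul_cancel₀ _ hdet
    ext
    · apply mul_right_cancel₀ hdet
      simp only [φ, Prod.fst_add, Int.fract]
      linear_combination (-b.1.1) * hx' - b.2.1 * hy' + z.1 * hd
    · apply mul_right_cancel₀ hdet
      simp only [φ, Prod.snd_add, Int.fract]
      linear_combination (-b.1.2) * hx' - b.2.2 * hy' + z.2 * hd
  rw [hz, hper _ hl]
  exact hr ⟨⟨Int.fract_nonneg _, (Int.fract_lt_one _).le⟩,
    ⟨Int.fract_nonneg _, (Int.fract_lt_one _).le⟩⟩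

/-- At a point where `|g|` is maximal, applying `T` would multiply this maximum by `|r| > 1`. -/
lemma eq_zero_of_periodic_of_expanding {b : Plane × Plane} (hb : b ∈ biFan L) {g : Plane → ℝ}
    (hg : Continuous g) (hper : ∀ l ∈ L, ∀ z, g (z + l) = g z) {r : ℝ} (hr : 1 < |r|)
    {T : Plane → Plane} (hT : ∀ z, g (T z) = r * g z) (z : Plane) : g z = 0 := by
  obtain ⟨z₀, h₀⟩ := exists_abs_le_of_periodic hb hg hper
  have h := h₀ (T z₀)
  rw [hT, abs_mul] at h
  have h1 : |g z₀| = 0 := by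
    have := abs_nonneg (g z₀)
    nlinarith
  have := h₀ z
  rw [h1] at this
  exact abs_eq_zero.1 (le_antisymm this (abs_nonneg _))

/-- For a lift `H` of `h`, both `H (z + l) - H z` and `H (D z) - D (H z)` stay at lattice-valued
distance from what commutation predicts, so they are constant in `z` by discreteness of `L`. The
first constant is additive in `l`, the second makes it commute with `D`; hence it is diagonal.
Subtracting the corresponding affine map leaves periodic functions to which
`eq_zero_of_periodic_of_expanding` applies. -/
theorem exists_affine_of_commute [DiscreteTopology L] [IsZLattice ℝ L] (D : HyperbolicToralAut L)
    (h : (Plane ⧸ L) ≃ₜ (Plane ⧸ L)) (hD : ∀ x, h (D.torusMap x) = D.torusMap (h x)) :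
    ∃ α β : ℝ, ∃ c : Plane, α ≠ 0 ∧ β ≠ 0 ∧
      ∀ z : Plane, h (L.mkQ z) = L.mkQ (α * z.1 + c.1, β * z.2 + c.2) := by
  obtain ⟨b, hb⟩ := biFan_nonempty D
  have hcont : Continuous L.mkQ := isCoveringMap_mkQ.continuous
  obtain ⟨e₀, he₀⟩ := L.mkQ_surjective (h (L.mkQ 0))
  obtain ⟨H, ⟨-, hH⟩, -⟩ := isCoveringMap_mkQ.existsUnique_continuousMap_lifts
    ⟨fun z => h (L.mkQ z), h.continuous.comp hcont⟩ (0 : Plane) e₀ he₀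
  have hH : ∀ z, L.mkQ (H z) = h (L.mkQ z) := fun z => congrFun hH z
  have hHc : Continuous H := H.continuous
  have hper : ∀ l ∈ L, ∀ z, H (z + l) - H z = H l - H 0 := by
    intro l hl z
    have h1 : ∀ z, H (z + l) - H z ∈ L := fun z => by
      rw [← mkQ_eq_iff, hH, hH]
      congr 1
      rw [mkQ_eq_iff]
      simpa using hl
    have h2 := exists_eq_const_of_forall_mem (by fun_prop) h1 z 0
    simpa using h2
  have hDc : Continuous D.planeMap := by
    change Continuous fun z : Plane => (D.mu * z.1, D.lam * z.2)
    fun_prop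
  have hcomm : ∀ z, H (D.planeMap z) - D.planeMap (H z) = H 0 - D.planeMap (H 0) := by
    intro z
    have h1 : ∀ z, H (D.planeMap z) - D.planeMap (H z) ∈ L := fun z => by
      rw [← mkQ_eq_iff, hH, ← D.torusMap_mkQ, ← D.torusMap_mkQ, hH, hD]
    have h2 := exists_eq_const_of_forall_mem (by fun_prop) h1 z 0
    simpa using h2
  let A : L →+ Plane :=
    { toFun := fun l => H l - H 0
      map_zero' := by simp
      map_add' := fun l m => by
        rw [Submodule.coe_add, ← hper m m.2 l]
        abel }
  have hA : ∀ m n : ℤ, ∀ l : Plane, l ∈ L → l.1 = m * b.1.1 + n * b.2.1 →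
      l.2 = m * b.1.2 + n * b.2.2 →
      (H l - H 0).1 = m * (H b.1 - H 0).1 + n * (H b.2 - H 0).1 ∧
      (H l - H 0).2 = m * (H b.1 - H 0).2 + n * (H b.2 - H 0).2 := by
    intro m n l hl h1 h2
    have hl' : (⟨l, hl⟩ : L) = m • ⟨b.1, biFan_fst_mem hb⟩ + n • ⟨b.2, biFan_snd_mem hb⟩ := by
      apply Subtype.ext
      change l = m • b.1 + n • b.2
      apply Prod.ext
      · rw [h1, Prod.fst_add, Prod.smul_fst, Prod.smul_fst, zsmul_eq_mul, zsmul_eq_mul]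
      · rw [h2, Prod.snd_add, Prod.smul_snd, Prod.smul_snd, zsmul_eq_mul, zsmul_eq_mul]
    have h3 : H l - H 0 = m • (H b.1 - H 0) + n • (H b.2 - H 0) := by
      have := congrArg A hl'
      rwa [map_add, map_zsmul, map_zsmul] at this
    rw [h3, Prod.fst_add, Prod.smul_fst, Prod.smul_fst, zsmul_eq_mul, zsmul_eq_mul,
      Prod.snd_add, Prod.smul_snd, Prod.smul_snd, zsmul_eq_mul, zsmul_eq_mul]
    exact ⟨rfl, rfl⟩
  have hAD : H (D.planeMap b.1) - H 0 = D.planeMap (H b.1 - H 0) := by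
    rw [map_sub]
    linear_combination hcomm b.1
  obtain ⟨m, n, hn, hm1, hm2⟩ := D.exists_coeff hb
  have hDb := hA m n (D.planeMap b.1) ((D.planeMap_mem_iff _).2 (biFan_fst_mem hb)) hm1 hm2
  rw [hAD] at hDb
  obtain ⟨hDb1, hDb2⟩ := hDb
  simp only [D.planeMap_apply] at hDb1 hDb2
  obtain ⟨⟨a1, a2⟩, hAe⟩ : ∃ p, H b.1 - H 0 = p := ⟨_, rfl⟩
  obtain ⟨⟨a1', a2'⟩, hAf⟩ : ∃ p, H b.2 - H 0 = p := ⟨_, rfl⟩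
  rw [hAe, hAf] at hDb1 hDb2 hA
  simp only at hDb1 hDb2 hA
  have he1 := hb.1.ne'
  have he2 := hb.2.1.ne'
  set α := a1 / b.1.1 with hα
  set β := a2 / b.1.2 with hβ
  have hae1 : a1 = α * b.1.1 := by rw [hα]; field_simp
  have hae2 : a2 = β * b.1.2 := by rw [hβ]; field_simp
  -- The relation `μ e₁ = m e₁ + n f₁` with `n ≠ 0` holds for the images as well, so the first
  -- coordinates of `e` and `f` are scaled by the same factor.
  have haf1 : a1' = α * b.2.1 := by
    apply mul_left_cancel₀ hn
    rw [hae1] at hDb1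
    linear_combination (-1) * hDb1 + α * hm1
  have haf2 : a2' = β * b.2.2 := by
    apply mul_left_cancel₀ hn
    rw [hae2] at hDb2
    linear_combination (-1) * hDb2 + β * hm2
  have hAl : ∀ l ∈ L, ∀ z, (H (z + l)).1 = (H z).1 + α * l.1 ∧
      (H (z + l)).2 = (H z).2 + β * l.2 := by
    intro l hl z
    obtain ⟨m, n, h1, h2⟩ := (mem_iff_of_biFan hb).1 hl
    obtain ⟨h3, h4⟩ := hA m n l hl h1 h2
    rw [← hper l hl z, Prod.fst_sub] at h3
    rw [← hper l hl z, Prod.snd_sub] at h4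
    constructor
    · rw [h1]; linear_combination h3 + m * hae1 + n * haf1
    · rw [h2]; linear_combination h4 + m * hae2 + n * haf2
  have hmu1 : 1 - D.mu ≠ 0 := fun h => by
    have := D.abs_mu_lt_one
    rw [← sub_eq_zero.1 h, abs_one] at this
    exact lt_irrefl _ this
  have hlam1 : 1 - D.lam ≠ 0 := fun h => by
    have := D.one_lt_abs_lam
    rw [← sub_eq_zero.1 h, abs_one] at this
    exact lt_irrefl _ this
  -- The translation part `c` solves `c - D c = H 0 - D (H 0)`, the constant commutator found in
  -- `hcomm`.
  set c1 := (H 0 - D.planeMap (H 0)).1 / (1 - D.mu) with hc1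
  set c2 := (H 0 - D.planeMap (H 0)).2 / (1 - D.lam) with hc2
  have hc1' : c1 * (1 - D.mu) = (H 0 - D.planeMap (H 0)).1 := div_mul_cancel₀ _ hmu1
  have hc2' : c2 * (1 - D.lam) = (H 0 - D.planeMap (H 0)).2 := div_mul_cancel₀ _ hlam1
  -- In the stable coordinate the expansion comes from the inverse of `D`.
  have hg1 : ∀ z, (H z).1 - α * z.1 - c1 = 0 := by
    refine eq_zero_of_periodic_of_expanding hb (by fun_prop) (fun l hl z => ?_) (r := D.mu⁻¹)
      (by rw [abs_inv]; exact (one_lt_inv₀ D.abs_mu_pos).2 D.abs_mu_lt_one)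
      (T := fun z => (D.mu⁻¹ * z.1, D.lam⁻¹ * z.2)) (fun z => ?_)
    · rw [(hAl l hl z).1, Prod.fst_add]; ring
    · have h1 := congrArg Prod.fst (hcomm (D.mu⁻¹ * z.1, D.lam⁻¹ * z.2))
      have h2 : D.planeMap (D.mu⁻¹ * z.1, D.lam⁻¹ * z.2) = z := by
        have := D.mu_ne_zero
        have := D.lam_ne_zero
        rw [D.planeMap_apply]
        ext <;> field_simp
      rw [h2, ← hc1', Prod.fst_sub] at h1
      simp only [D.planeMap_apply] at h1
      have hm := mul_inv_cancel₀ D.mu_ne_zero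
      apply mul_left_cancel₀ D.mu_ne_zero
      linear_combination (-1) * h1 + (c1 - (H z).1) * hm
  have hg2 : ∀ z, (H z).2 - β * z.2 - c2 = 0 := by
    refine eq_zero_of_periodic_of_expanding hb (by fun_prop) (fun l hl z => ?_) (r := D.lam)
      D.one_lt_abs_lam (T := D.planeMap) (fun z => ?_)
    · rw [(hAl l hl z).2, Prod.snd_add]; ring
    · have h1 := congrArg Prod.snd (hcomm z)
      rw [← hc2', Prod.snd_sub] at h1
      simp only [D.planeMap_apply] at h1 ⊢
      linear_combination h1
  have hform : ∀ z : Plane, h (L.mkQ z) = L.mkQ (α * z.1 + c1, β * z.2 + c2) := fun z => by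
    rw [← hH]
    congr 1
    ext
    · linear_combination hg1 z
    · linear_combination hg2 z
  refine ⟨α, β, (c1, c2), fun hα0 => ?_, fun hβ0 => ?_, hform⟩
  · have h1 : L.mkQ ((1, 0) : Plane) = L.mkQ 0 := h.injective (by rw [hform, hform, hα0]; simp)
    rw [mkQ_eq_iff, sub_zero] at h1
    simpa using D.axisFree.2 _ h1 rfl
  · have h1 : L.mkQ ((0, 1) : Plane) = L.mkQ 0 := h.injective (by rw [hform, hform, hβ0]; simp)
    rw [mkQ_eq_iff, sub_zero] at h1
    simpa using D.axisFree.1 _ h1 rfl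

end Affine

/-! ### The cutting algorithm -/

section Cutting

variable {L : Submodule ℤ Plane} {b b' : Plane × Plane}

lemma cutForward_of_pos (h : 0 < (b.1 + b.2).1) : cutForward b = (b.1 + b.2, b.2) := if_pos h

lemma cutForward_of_not_pos (h : ¬ 0 < (b.1 + b.2).1) : cutForward b = (b.1, b.1 + b.2) :=
  if_neg h

lemma cutBackward_of_pos (h : 0 < (b.1 - b.2).2) : cutBackward b = (b.1 - b.2, b.2) := if_pos h

lemma cutBackward_of_not_pos (h : ¬ 0 < (b.1 - b.2).2) : cutBackward b = (b.1, b.2 - b.1) :=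
  if_neg h

lemma biFan_add_fst_ne_zero (hL : AxisFree L) (hb : b ∈ biFan L) : (b.1 + b.2).1 ≠ 0 := by
  intro h
  have h0 := hL.1 _ (L.add_mem (biFan_fst_mem hb) (biFan_snd_mem hb)) h
  have h1 := congrArg Prod.snd h0
  rw [Prod.snd_add, Prod.snd_zero] at h1
  linarith [hb.2.1, hb.2.2.2.1]

lemma biFan_sub_snd_ne_zero (hL : AxisFree L) (hb : b ∈ biFan L) : (b.1 - b.2).2 ≠ 0 := by
  intro h
  have h0 := hL.2 _ (L.sub_mem (biFan_fst_mem hb) (biFan_snd_mem hb)) h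
  have h1 := congrArg Prod.fst h0
  rw [Prod.fst_sub, Prod.fst_zero] at h1
  linarith [hb.1, hb.2.2.1]

lemma cutForward_mem (hL : AxisFree L) (hb : b ∈ biFan L) : cutForward b ∈ biFan L := by
  have h0 := biFan_add_fst_ne_zero hL hb
  obtain ⟨h1, h2, h3, h4, h5⟩ := hb
  by_cases h : 0 < (b.1 + b.2).1
  · rw [cutForward_of_pos h]
    refine ⟨h, add_pos h2 h4, h3, h4, ?_⟩
    rw [← h5, ← span_sub_left (b.1 + b.2), add_sub_cancel_right]
  · rw [cutForward_of_not_pos h]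
    refine ⟨h1, h2, lt_of_le_of_ne (not_lt.1 h) h0, add_pos h2 h4, ?_⟩
    rw [← h5, ← span_sub_right, add_sub_cancel_left]

lemma cutBackward_mem (hL : AxisFree L) (hb : b ∈ biFan L) : cutBackward b ∈ biFan L := by
  have h0 := biFan_sub_snd_ne_zero hL hb
  obtain ⟨h1, h2, h3, h4, h5⟩ := hb
  by_cases h : 0 < (b.1 - b.2).2
  · rw [cutBackward_of_pos h]
    exact ⟨by simp only [Prod.fst_sub]; linarith, h, h3, h4, by rw [span_sub_left, h5]⟩
  · rw [cutBackward_of_not_pos h]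
    refine ⟨h1, h2, by simp only [Prod.fst_sub]; linarith, ?_, by rw [span_sub_right, h5]⟩
    have := lt_of_le_of_ne (not_lt.1 h) h0
    simp only [Prod.snd_sub] at this ⊢
    linarith

/-- The sign of the height of `e - f` remembers which branch was taken: replacing `e` by `e + f`
leaves the difference `e`, of positive height, and replacing `f` by `e + f` leaves `-f`, of negative
height. -/
lemma cutBackward_cutForward (hb : b ∈ biFan L) : cutBackward (cutForward b) = b := by
  obtain ⟨h1, h2, h3, h4, -⟩ := hb
  by_cases h : 0 < (b.1 + b.2).1
  · rw [cutForward_of_pos h, cutBackward_of_pos (by simpa using h2)]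
    simp
  · rw [cutForward_of_not_pos h, cutBackward_of_not_pos (by simpa using h4.le)]
    simp

lemma cutForward_cutBackward (hb : b ∈ biFan L) : cutForward (cutBackward b) = b := by
  obtain ⟨h1, h2, h3, h4, -⟩ := hb
  by_cases h : 0 < (b.1 - b.2).2
  · rw [cutBackward_of_pos h, cutForward_of_pos (by simpa using h1)]
    simp
  · rw [cutBackward_of_not_pos h, cutForward_of_not_pos (by simpa using h3.le)]
    simp

lemma cutBackward_iterate_mem (hL : AxisFree L) (hb : b ∈ biFan L) (n : ℕ) :
    cutBackward^[n] b ∈ biFan L := by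
  induction n with
  | zero => exact hb
  | succ n ih => rw [Function.iterate_succ_apply']; exact cutBackward_mem hL ih

lemma cutForward_iterate_mem (hL : AxisFree L) (hb : b ∈ biFan L) (n : ℕ) :
    cutForward^[n] b ∈ biFan L := by
  induction n with
  | zero => exact hb
  | succ n ih => rw [Function.iterate_succ_apply']; exact cutForward_mem hL ih

lemma cutBasis_mem (hL : AxisFree L) (hb : b ∈ biFan L) (n : ℤ) : cutBasis b n ∈ biFan L := by
  cases n with
  | ofNat n => exact cutForward_iterate_mem hL hb n
  | negSucc n => exact cutBackward_iterate_mem hL hb (n + 1)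

lemma cutBasis_neg_natCast (n : ℕ) : cutBasis b (-(n : ℤ)) = cutBackward^[n] b := by
  cases n with
  | zero => rfl
  | succ n => rfl

lemma cutBasis_add_one (hL : AxisFree L) (hb : b ∈ biFan L) (n : ℤ) :
    cutBasis b (n + 1) = cutForward (cutBasis b n) := by
  cases n with
  | ofNat n => exact Function.iterate_succ_apply' cutForward n b
  | negSucc n =>
    have h : Int.negSucc n + 1 = -(n : ℤ) := by omega
    rw [h, cutBasis_neg_natCast]
    change _ = cutForward (cutBackward^[n + 1] b)
    rw [Function.iterate_succ_apply',
      cutForward_cutBackward (cutBackward_iterate_mem hL hb n)]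

lemma cutBasis_sub_one (hL : AxisFree L) (hb : b ∈ biFan L) (n : ℤ) :
    cutBasis b (n - 1) = cutBackward (cutBasis b n) := by
  have h := cutBasis_add_one hL hb (n - 1)
  rw [sub_add_cancel] at h
  rw [h, cutBackward_cutForward (cutBasis_mem hL hb _)]

lemma cuttingSeq_eq_one (hL : AxisFree L) (hb : b ∈ biFan L) {n : ℤ}
    (h : 0 < ((cutBasis b n).1 + (cutBasis b n).2).1) : cuttingSeq b n = 1 := by
  rw [cuttingSeq, if_pos]
  rw [cutBasis_add_one hL hb, cutForward_of_pos h]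

lemma cuttingSeq_eq_zero (hL : AxisFree L) (hb : b ∈ biFan L) {n : ℤ}
    (h : ¬ 0 < ((cutBasis b n).1 + (cutBasis b n).2).1) : cuttingSeq b n = 0 := by
  rw [cuttingSeq, if_neg]
  rw [cutBasis_add_one hL hb, cutForward_of_not_pos h]
  intro h0
  have h1 := congrArg Prod.fst h0
  have h2 := (cutBasis_mem hL hb n).1
  simp only [Prod.fst_add] at h1
  linarith

lemma cuttingSeq_eq_ite (hL : AxisFree L) (hb : b ∈ biFan L) (n : ℤ) [Decidable
    (0 < ((cutBasis b n).1 + (cutBasis b n).2).1)] :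
    cuttingSeq b n = if 0 < ((cutBasis b n).1 + (cutBasis b n).2).1 then 1 else 0 := by
  split_ifs with h
  · exact cuttingSeq_eq_one hL hb h
  · exact cuttingSeq_eq_zero hL hb h

/-! ### The cutting algorithm reaches every basis of the bi-fan -/

/-- The change of basis has determinant ±1, and both bases are positively oriented. -/
lemma biFan_det_eq (hb : b ∈ biFan L) (hb' : b' ∈ biFan L) :
    b'.1.1 * b'.2.2 - b'.1.2 * b'.2.1 = b.1.1 * b.2.2 - b.1.2 * b.2.1 := by
  have key : ∀ {b b' : Plane × Plane}, b ∈ biFan L → b' ∈ biFan L → ∃ k : ℤ,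
      b'.1.1 * b'.2.2 - b'.1.2 * b'.2.1 = k * (b.1.1 * b.2.2 - b.1.2 * b.2.1) := by
    intro b b' hb hb'
    obtain ⟨m, n, h1, h2⟩ := (mem_iff_of_biFan hb).1 (biFan_fst_mem hb')
    obtain ⟨m', n', h3, h4⟩ := (mem_iff_of_biFan hb).1 (biFan_snd_mem hb')
    refine ⟨m * n' - n * m', ?_⟩
    rw [h1, h2, h3, h4]
    push_cast
    ring
  obtain ⟨k, hk⟩ := key hb hb'
  obtain ⟨k', hk'⟩ := key hb' hb
  have hp := biFan_det_pos hb
  have hp' := biFan_det_pos hb'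
  set d := b.1.1 * b.2.2 - b.1.2 * b.2.1
  set d' := b'.1.1 * b'.2.2 - b'.1.2 * b'.2.1
  have hkk : (k : ℝ) * k' = 1 := by
    apply mul_right_cancel₀ hp'.ne'
    rw [mul_assoc, ← hk', one_mul, hk]
  have hkpos : (0 : ℝ) < k := by
    by_contra! h
    nlinarith
  have hk1 : k = 1 := by
    have h1 : k * k' = 1 := by exact_mod_cast hkk
    have h2 : 0 < k := by exact_mod_cast hkpos
    rcases Int.eq_one_or_neg_one_of_mul_eq_one h1 with h | h <;> omega
  rw [hk, hk1]
  simp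

/-- In a natural matrix of determinant 1 other than the identity, one row dominates the other; this
is what tells which backward cutting step keeps the coordinates nonnegative. -/
lemma nat_det_one_cases {a b c d : ℕ} (h : a * d = b * c + 1) :
    (a = 1 ∧ b = 0 ∧ c = 0 ∧ d = 1) ∨ (c ≤ a ∧ d ≤ b) ∨ (a ≤ c ∧ b ≤ d) := by
  by_cases h1 : c ≤ a
  · by_cases h2 : d ≤ b
    · exact Or.inr (Or.inl ⟨h1, h2⟩)
    · push Not at h2
      have h3 : a ≤ 1 := by nlinarith
      have h4 : a = 1 := by
        rcases Nat.le_one_iff_eq_zero_or_eq_one.1 h3 with rfl | h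
        · simp at h
        · exact h
      subst h4
      have h5 : c = 0 ∨ c = 1 := by omega
      rcases h5 with rfl | rfl
      · left; omega
      · right; right; omega
  · by_cases h2 : b ≤ d
    · right; right; omega
    · push Not at h1 h2
      nlinarith

/-- Induction on the sum of the coordinates of `b'` in `b`. Since `e` and `f` have positive heights,
a dominating row of the coordinate matrix is the higher vector, so `cutBackward` subtracts the
smaller row from the larger one and the sum decreases. -/
lemma exists_iterate_of_nonneg (hL : AxisFree L) (hb : b ∈ biFan L) (N : ℕ) :
    ∀ (b' : Plane × Plane) (a c a' c' : ℕ), b' ∈ biFan L → a + c + a' + c' ≤ N →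
      b'.1.1 = a * b.1.1 + c * b.2.1 → b'.1.2 = a * b.1.2 + c * b.2.2 →
      b'.2.1 = a' * b.1.1 + c' * b.2.1 → b'.2.2 = a' * b.1.2 + c' * b.2.2 →
      ∃ n : ℕ, b' = cutForward^[n] b := by
  induction N with
  | zero =>
    intro b' a c a' c' hb' hN h1
    obtain ⟨rfl, rfl⟩ : a = 0 ∧ c = 0 := by omega
    have := hb'.1
    simp [h1] at this
  | succ N ih =>
    intro b' a c a' c' hb' hN h1 h2 h3 h4
    have hdet := biFan_det_eq hb hb'
    have hdp := biFan_det_pos hb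
    have hnat : a * c' = c * a' + 1 := by
      have : ((a : ℝ) * c' - c * a' - 1) * (b.1.1 * b.2.2 - b.1.2 * b.2.1) = 0 := by
        rw [h1, h2, h3, h4] at hdet
        linear_combination hdet
      have := (mul_eq_zero.1 this).resolve_right hdp.ne'
      have : (a : ℝ) * c' = c * a' + 1 := by linarith
      exact_mod_cast this
    have hback := cutForward_cutBackward hb'
    have hbm := cutBackward_mem hL hb'
    have he2 := hb.2.1
    have hf2 := hb.2.2.2.1
    rcases nat_det_one_cases hnat with ⟨rfl, rfl, rfl, rfl⟩ | ⟨ha, hc⟩ | ⟨ha, hc⟩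
    · refine ⟨0, ?_⟩
      rw [Function.iterate_zero_apply]
      ext <;> simp_all
    · obtain ⟨x, rfl⟩ := Nat.exists_eq_add_of_le ha
      obtain ⟨y, rfl⟩ := Nat.exists_eq_add_of_le hc
      have hpos : 0 < (b'.1 - b'.2).2 := by
        -- Equal rows would give determinant 0.
        have hx : x ≠ 0 ∨ y ≠ 0 := by
          by_contra! h
          obtain ⟨rfl, rfl⟩ := h
          simp only [add_zero] at hnat
          linarith [mul_comm a' c']
        rw [Prod.snd_sub, h2, h4]
        push_cast
        rcases hx with hx | hx
        · have : (0 : ℝ) < x := by positivity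
          nlinarith [mul_pos this he2, mul_nonneg (Nat.cast_nonneg (α := ℝ) y) hf2.le]
        · have : (0 : ℝ) < y := by positivity
          nlinarith [mul_pos this hf2, mul_nonneg (Nat.cast_nonneg (α := ℝ) x) he2.le]
      rw [cutBackward_of_pos hpos] at hback hbm
      have hlt : 0 < a' + c' := by
        rcases Nat.eq_zero_or_pos (a' + c') with h | h
        · obtain ⟨rfl, rfl⟩ : a' = 0 ∧ c' = 0 := by omega
          simp at hnat
        · exact h
      obtain ⟨n, hn⟩ := ih (b'.1 - b'.2, b'.2) x y a' c' hbm (by omega)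
        (by simp only [Prod.fst_sub]; rw [h1, h3]; push_cast; ring)
        (by simp only [Prod.snd_sub]; rw [h2, h4]; push_cast; ring) h3 h4
      exact ⟨n + 1, by rw [Function.iterate_succ_apply', ← hn, hback]⟩
    · obtain ⟨x, rfl⟩ := Nat.exists_eq_add_of_le ha
      obtain ⟨y, rfl⟩ := Nat.exists_eq_add_of_le hc
      have hpos : ¬ 0 < (b'.1 - b'.2).2 := by
        rw [Prod.snd_sub, h2, h4]
        push_cast
        nlinarith [mul_nonneg (Nat.cast_nonneg (α := ℝ) x) he2.le,
          mul_nonneg (Nat.cast_nonneg (α := ℝ) y) hf2.le]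
      rw [cutBackward_of_not_pos hpos] at hback hbm
      have hlt : 0 < a + c := by
        rcases Nat.eq_zero_or_pos (a + c) with h | h
        · obtain ⟨rfl, rfl⟩ : a = 0 ∧ c = 0 := by omega
          simp at hnat
        · exact h
      obtain ⟨n, hn⟩ := ih (b'.1, b'.2 - b'.1) a c x y hbm (by omega) h1 h2
        (by simp only [Prod.fst_sub]; rw [h1, h3]; push_cast; ring)
        (by simp only [Prod.snd_sub]; rw [h2, h4]; push_cast; ring)
      exact ⟨n + 1, by rw [Function.iterate_succ_apply', ← hn, hback]⟩

lemma cutBackward_iterate_cutForward_iterate (hL : AxisFree L) (hb : b ∈ biFan L) (n : ℕ) :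
    cutBackward^[n] (cutForward^[n] b) = b := by
  induction n with
  | zero => rfl
  | succ n ih =>
    rw [Function.iterate_succ_apply, Function.iterate_succ_apply',
      cutBackward_cutForward (cutForward_iterate_mem hL hb n), ih]

/-- The quadrant conditions make the diagonal of the change-of-basis matrix positive, and
determinant 1 then keeps the off-diagonal entries from having opposite signs. Either the matrix or
its inverse is thus nonnegative, and the cutting algorithm leads from `b` forward to `b'` or from
`b'` forward to `b`. -/
theorem exists_cutBasis_eq (hL : AxisFree L) (hb : b ∈ biFan L) (hb' : b' ∈ biFan L) :
    ∃ n : ℤ, b' = cutBasis b n := by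
  obtain ⟨a, c, h1, h2⟩ := (mem_iff_of_biFan hb).1 (biFan_fst_mem hb')
  obtain ⟨a', c', h3, h4⟩ := (mem_iff_of_biFan hb).1 (biFan_snd_mem hb')
  have hdet := biFan_det_eq hb hb'
  have hdp := biFan_det_pos hb
  have hone : (a : ℝ) * c' - c * a' = 1 := by
    have : ((a : ℝ) * c' - c * a' - 1) * (b.1.1 * b.2.2 - b.1.2 * b.2.1) = 0 := by
      rw [h1, h2, h3, h4] at hdet
      linear_combination hdet
    linarith [(mul_eq_zero.1 this).resolve_right hdp.ne']
  have hint : a * c' - c * a' = 1 := by exact_mod_cast hone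
  obtain ⟨p1, p2, p3, p4, -⟩ := id hb
  obtain ⟨q1, q2, q3, q4, -⟩ := id hb'
  have pos_of : ∀ {x y : ℤ} {u v : ℝ}, 0 < u → 0 < v → x ≤ 0 → 0 < x * u + y * v → 0 < y := by
    intro x y u v hu hv hx h
    have hx' : (x : ℝ) ≤ 0 := by exact_mod_cast hx
    have : (0 : ℝ) < y := by
      by_contra! hy
      nlinarith
    exact_mod_cast this
  -- With `a ≤ 0`, positive height forces `c > 0`, and then the abscissa of `b'.1` is negative.
  have ha : 0 < a := by
    by_contra! hle
    have hc : (0 : ℝ) < c := by exact_mod_cast pos_of p2 p4 hle (h2 ▸ q2)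
    have hle' : (a : ℝ) ≤ 0 := by exact_mod_cast hle
    nlinarith
  have hc' : 0 < c' := by
    by_contra! hle
    have hc : (0 : ℝ) < a' := by
      exact_mod_cast pos_of (x := c') p4 p2 hle (by rw [h4] at q4; linarith)
    have hle' : (c' : ℝ) ≤ 0 := by exact_mod_cast hle
    nlinarith
  have hprod : 0 ≤ c * a' := by nlinarith
  by_cases hs : 0 ≤ c ∧ 0 ≤ a'
  · lift a to ℕ using ha.le
    lift c' to ℕ using hc'.le
    obtain ⟨hc, ha'⟩ := hs
    lift c to ℕ using hc
    lift a' to ℕ using ha'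
    push_cast at h1 h2 h3 h4
    obtain ⟨n, hn⟩ := exists_iterate_of_nonneg hL hb _ b' a c a' c' hb' le_rfl h1 h2 h3 h4
    exact ⟨n, hn⟩
  · have hs' : c ≤ 0 ∧ a' ≤ 0 := by
      by_contra hs'
      rcases lt_trichotomy c 0 with h | h | h <;> rcases lt_trichotomy a' 0 with h' | h' | h' <;>
        first | omega | nlinarith
    obtain ⟨hc, ha'⟩ := hs'
    obtain ⟨a, rfl⟩ := Int.eq_ofNat_of_zero_le ha.le
    obtain ⟨c', rfl⟩ := Int.eq_ofNat_of_zero_le hc'.le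
    obtain ⟨x, hx⟩ := Int.eq_ofNat_of_zero_le (neg_nonneg.2 hc)
    obtain ⟨y, hy⟩ := Int.eq_ofNat_of_zero_le (neg_nonneg.2 ha')
    obtain rfl : c = -x := by omega
    obtain rfl : a' = -y := by omega
    push_cast at h1 h2 h3 h4 hone
    -- The inverse matrix has entries `c', -c, -a', a`, all nonnegative here.
    obtain ⟨n, hn⟩ := exists_iterate_of_nonneg hL hb' _ b c' x y a hb le_rfl
      (by rw [h1, h3]; linear_combination (-b.1.1) * hone)
      (by rw [h2, h4]; linear_combination (-b.1.2) * hone)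
      (by rw [h1, h3]; linear_combination (-b.2.1) * hone)
      (by rw [h2, h4]; linear_combination (-b.2.2) * hone)
    refine ⟨-n, ?_⟩
    rw [cutBasis_neg_natCast, hn, cutBackward_iterate_cutForward_iterate hL hb']

end Cutting

/-! ### Diagonal maps between bases of the bi-fan and shifts of the cutting sequence -/

/-- The linear map `diag(α, β)` of the plane. -/
def diagMap (α β : ℝ) (z : Plane) : Plane := (α * z.1, β * z.2)

/-- `diag(α, β)` takes `(e, f)` into `(e', f')`. -/
def DiagSame (α β : ℝ) (b b' : Plane × Plane) : Prop :=
  b' = (diagMap α β b.1, diagMap α β b.2)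

/-- `diag(-α, β)` takes `(e, f)` into `(f', e')`. -/
def DiagFlip (α β : ℝ) (b b' : Plane × Plane) : Prop :=
  b' = (diagMap (-α) β b.2, diagMap (-α) β b.1)

/-- A diagonal map, with positive second entry, takes one basis of the bi-fan into the other. -/
def DiagRel (b b' : Plane × Plane) : Prop :=
  ∃ α β : ℝ, 0 < α ∧ 0 < β ∧ (DiagSame α β b b' ∨ DiagFlip α β b b')

section Shift

variable {L : Submodule ℤ Plane} {b b' : Plane × Plane} {α β : ℝ}

lemma diagMap_add (z w : Plane) : diagMap α β (z + w) = diagMap α β z + diagMap α β w := by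
  ext <;> simp [diagMap, mul_add]

lemma diagMap_sub (z w : Plane) : diagMap α β (z - w) = diagMap α β z - diagMap α β w := by
  ext <;> simp [diagMap, mul_sub]

lemma diagSame_cutForward (hα : 0 < α) (h : DiagSame α β b b') :
    DiagSame α β (cutForward b) (cutForward b') ∧
      (0 < (b'.1 + b'.2).1 ↔ 0 < (b.1 + b.2).1) := by
  subst h
  have hiff : 0 < (diagMap α β b.1 + diagMap α β b.2).1 ↔ 0 < (b.1 + b.2).1 := by
    rw [← diagMap_add]
    exact mul_pos_iff_of_pos_left hα
  refine ⟨?_, hiff⟩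
  by_cases hp : 0 < (b.1 + b.2).1
  · rw [DiagSame, cutForward_of_pos hp, cutForward_of_pos (hiff.2 hp), diagMap_add]
  · rw [DiagSame, cutForward_of_not_pos hp, cutForward_of_not_pos (mt hiff.1 hp), diagMap_add]

/-- The reflection exchanges the left and right half-planes and thereby the two branches;
axis-freeness excludes the undecided case of a vertical `e + f`. -/
lemma diagFlip_cutForward (hL : AxisFree L) (hb : b ∈ biFan L) (hα : 0 < α)
    (h : DiagFlip α β b b') : DiagFlip α β (cutForward b) (cutForward b') ∧
      (0 < (b'.1 + b'.2).1 ↔ ¬ 0 < (b.1 + b.2).1) := by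
  subst h
  have h0 := biFan_add_fst_ne_zero hL hb
  have hiff : 0 < (diagMap (-α) β b.2 + diagMap (-α) β b.1).1 ↔ ¬ 0 < (b.1 + b.2).1 := by
    rw [← diagMap_add, add_comm b.2]
    change 0 < -α * _ ↔ _
    rw [neg_mul, ← mul_neg, mul_pos_iff_of_pos_left hα, neg_pos, not_lt]
    exact ⟨le_of_lt, fun h => lt_of_le_of_ne h h0⟩
  refine ⟨?_, hiff⟩
  by_cases hp : 0 < (b.1 + b.2).1
  · rw [DiagFlip, cutForward_of_pos hp, cutForward_of_not_pos (fun h => hiff.1 h hp), diagMap_add,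
      add_comm]
  · rw [DiagFlip, cutForward_of_not_pos hp, cutForward_of_pos (hiff.2 hp), diagMap_add,
      add_comm]

lemma diagSame_cutBackward (hβ : 0 < β) (h : DiagSame α β b b') :
    DiagSame α β (cutBackward b) (cutBackward b') := by
  subst h
  have hiff : 0 < (diagMap α β b.1 - diagMap α β b.2).2 ↔ 0 < (b.1 - b.2).2 := by
    rw [← diagMap_sub]
    exact mul_pos_iff_of_pos_left hβ
  by_cases hp : 0 < (b.1 - b.2).2
  · rw [DiagSame, cutBackward_of_pos hp, cutBackward_of_pos (hiff.2 hp), diagMap_sub]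
  · rw [DiagSame, cutBackward_of_not_pos hp, cutBackward_of_not_pos (mt hiff.1 hp), diagMap_sub]

lemma diagFlip_cutBackward (hL : AxisFree L) (hb : b ∈ biFan L) (hβ : 0 < β)
    (h : DiagFlip α β b b') : DiagFlip α β (cutBackward b) (cutBackward b') := by
  subst h
  have h0 := biFan_sub_snd_ne_zero hL hb
  have hiff : 0 < (diagMap (-α) β b.2 - diagMap (-α) β b.1).2 ↔ ¬ 0 < (b.1 - b.2).2 := by
    rw [← diagMap_sub, ← neg_sub b.1 b.2]
    change 0 < β * -(b.1 - b.2).2 ↔ _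
    rw [mul_pos_iff_of_pos_left hβ, neg_pos, not_lt]
    exact ⟨le_of_lt, fun h => lt_of_le_of_ne h h0⟩
  by_cases hp : 0 < (b.1 - b.2).2
  · rw [DiagFlip, cutBackward_of_pos hp, cutBackward_of_not_pos (fun h => hiff.1 h hp),
      diagMap_sub]
  · rw [DiagFlip, cutBackward_of_not_pos hp, cutBackward_of_pos (hiff.2 hp), diagMap_sub]

lemma diagSame_cutBasis (hL : AxisFree L) (hb : b ∈ biFan L) (hα : 0 < α) (hβ : 0 < β) {m n : ℤ}
    (h : DiagSame α β (cutBasis b m) (cutBasis b n)) (k : ℤ) :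
    DiagSame α β (cutBasis b (m + k)) (cutBasis b (n + k)) := by
  induction k with
  | zero => simpa using h
  | succ k ih =>
    rw [← add_assoc, ← add_assoc, cutBasis_add_one hL hb, cutBasis_add_one hL hb]
    exact (diagSame_cutForward hα ih).1
  | pred k ih =>
    rw [← add_sub_assoc, ← add_sub_assoc, cutBasis_sub_one hL hb, cutBasis_sub_one hL hb]
    exact diagSame_cutBackward hβ ih

lemma diagFlip_cutBasis (hL : AxisFree L) (hb : b ∈ biFan L) (hα : 0 < α) (hβ : 0 < β) {m n : ℤ}
    (h : DiagFlip α β (cutBasis b m) (cutBasis b n)) (k : ℤ) :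
    DiagFlip α β (cutBasis b (m + k)) (cutBasis b (n + k)) := by
  induction k with
  | zero => simpa using h
  | succ k ih =>
    rw [← add_assoc, ← add_assoc, cutBasis_add_one hL hb, cutBasis_add_one hL hb]
    exact (diagFlip_cutForward hL (cutBasis_mem hL hb _) hα ih).1
  | pred k ih =>
    rw [← add_sub_assoc, ← add_sub_assoc, cutBasis_sub_one hL hb, cutBasis_sub_one hL hb]
    exact diagFlip_cutBackward hL (cutBasis_mem hL hb _) hβ ih

lemma cuttingSeq_of_diagSame (hL : AxisFree L) (hb : b ∈ biFan L) (hα : 0 < α) (hβ : 0 < β)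
    {m n : ℤ} (h : DiagSame α β (cutBasis b m) (cutBasis b n)) (k : ℤ) :
    cuttingSeq b (n + k) = cuttingSeq b (m + k) := by
  classical
  have h1 := (diagSame_cutForward hα (diagSame_cutBasis hL hb hα hβ h k)).2
  rw [cuttingSeq_eq_ite hL hb, cuttingSeq_eq_ite hL hb]
  simp only [h1]

lemma cuttingSeq_of_diagFlip (hL : AxisFree L) (hb : b ∈ biFan L) (hα : 0 < α) (hβ : 0 < β)
    {m n : ℤ} (h : DiagFlip α β (cutBasis b m) (cutBasis b n)) (k : ℤ) :
    cuttingSeq b (n + k) = 1 - cuttingSeq b (m + k) := by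
  classical
  have h1 := (diagFlip_cutForward hL (cutBasis_mem hL hb _) hα
    (diagFlip_cutBasis hL hb hα hβ h k)).2
  rw [cuttingSeq_eq_ite hL hb, cuttingSeq_eq_ite hL hb]
  simp only [h1]
  split_ifs <;> simp

lemma cutBasis_add_one_of_one (hL : AxisFree L) (hb : b ∈ biFan L) {n : ℤ}
    (h : cuttingSeq b n = 1) : cutBasis b (n + 1) =
      ((cutBasis b n).1 + (cutBasis b n).2, (cutBasis b n).2) := by
  rw [cutBasis_add_one hL hb]
  by_cases hp : 0 < ((cutBasis b n).1 + (cutBasis b n).2).1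
  · exact cutForward_of_pos hp
  · rw [cuttingSeq_eq_zero hL hb hp] at h
    simp at h

lemma cutBasis_add_one_of_zero (hL : AxisFree L) (hb : b ∈ biFan L) {n : ℤ}
    (h : cuttingSeq b n = 0) : cutBasis b (n + 1) =
      ((cutBasis b n).1, (cutBasis b n).1 + (cutBasis b n).2) := by
  rw [cutBasis_add_one hL hb]
  by_cases hp : 0 < ((cutBasis b n).1 + (cutBasis b n).2).1
  · rw [cuttingSeq_eq_one hL hb hp] at h
    simp at h
  · exact cutForward_of_not_pos hp

lemma cuttingSeq_eq_zero_or_one (b : Plane × Plane) (n : ℤ) :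
    cuttingSeq b n = 0 ∨ cuttingSeq b n = 1 := by
  unfold cuttingSeq
  split_ifs <;> simp

/-- The integral coordinates of the `(m + k)`-th basis in the `m`-th one are determined by the
cutting sequence from `m` on. -/
lemma exists_common_coords (hL : AxisFree L) (hb : b ∈ biFan L) {m n : ℤ}
    (h : ∀ k, cuttingSeq b (n + k) = cuttingSeq b (m + k)) (k : ℤ) :
    ∃ x y x' y' : ℤ, ∀ j, j = m ∨ j = n →
      (cutBasis b (j + k)).1 = x • (cutBasis b j).1 + y • (cutBasis b j).2 ∧
      (cutBasis b (j + k)).2 = x' • (cutBasis b j).1 + y' • (cutBasis b j).2 := by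
  induction k with
  | zero => exact ⟨1, 0, 0, 1, fun j _ => by simp⟩
  | succ k ih =>
    obtain ⟨x, y, x', y', hk⟩ := ih
    rcases cuttingSeq_eq_zero_or_one b (m + k) with hs | hs
    · refine ⟨x, y, x + x', y + y', fun j hj => ?_⟩
      have hs' : cuttingSeq b (j + k) = 0 := by
        rcases hj with rfl | rfl
        · exact hs
        · rw [h, hs]
      obtain ⟨h1, h2⟩ := hk j hj
      rw [← add_assoc, cutBasis_add_one_of_zero hL hb hs', h1, h2]
      constructor
      · rfl
      · module
    · refine ⟨x + x', y + y', x', y', fun j hj => ?_⟩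
      have hs' : cuttingSeq b (j + k) = 1 := by
        rcases hj with rfl | rfl
        · exact hs
        · rw [h, hs]
      obtain ⟨h1, h2⟩ := hk j hj
      rw [← add_assoc, cutBasis_add_one_of_one hL hb hs', h1, h2]
      constructor
      · module
      · rfl
  | pred k ih =>
    obtain ⟨x, y, x', y', hk⟩ := ih
    rcases cuttingSeq_eq_zero_or_one b (m + (-k - 1)) with hs | hs
    · refine ⟨x, y, x' - x, y' - y, fun j hj => ?_⟩
      have hs' : cuttingSeq b (j + (-k - 1)) = 0 := by
        rcases hj with rfl | rfl
        · exact hs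
        · rw [h, hs]
      obtain ⟨h1, h2⟩ := hk j hj
      have h3 := cutBasis_add_one_of_zero hL hb hs'
      rw [show j + (-(k : ℤ) - 1) + 1 = j + -k by ring] at h3
      rw [h3] at h1 h2
      simp only at h1 h2
      refine ⟨h1, ?_⟩
      rw [h1] at h2
      rw [← sub_eq_iff_eq_add'.2 h2.symm]
      module
    · refine ⟨x - x', y - y', x', y', fun j hj => ?_⟩
      have hs' : cuttingSeq b (j + (-k - 1)) = 1 := by
        rcases hj with rfl | rfl
        · exact hs
        · rw [h, hs]
      obtain ⟨h1, h2⟩ := hk j hj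
      have h3 := cutBasis_add_one_of_one hL hb hs'
      rw [show j + (-(k : ℤ) - 1) + 1 = j + -k by ring] at h3
      rw [h3] at h1 h2
      simp only at h1 h2
      refine ⟨?_, h2⟩
      rw [h2] at h1
      rw [← sub_eq_iff_eq_add.2 h1.symm]
      module

/-- The mirrored form of `exists_common_coords`: complementary cutting sequences build the same
coordinates once `e` and `f` are exchanged at `n`. -/
lemma exists_common_coords_flip (hL : AxisFree L) (hb : b ∈ biFan L) {m n : ℤ}
    (h : ∀ k, cuttingSeq b (n + k) = 1 - cuttingSeq b (m + k)) (k : ℤ) :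
    ∃ x y x' y' : ℤ,
      ((cutBasis b (m + k)).1 = x • (cutBasis b m).1 + y • (cutBasis b m).2 ∧
      (cutBasis b (m + k)).2 = x' • (cutBasis b m).1 + y' • (cutBasis b m).2) ∧
      ((cutBasis b (n + k)).2 = x • (cutBasis b n).2 + y • (cutBasis b n).1 ∧
      (cutBasis b (n + k)).1 = x' • (cutBasis b n).2 + y' • (cutBasis b n).1) := by
  induction k with
  | zero => exact ⟨1, 0, 0, 1, by simp⟩
  | succ k ih =>
    obtain ⟨x, y, x', y', ⟨h1, h2⟩, h3, h4⟩ := ih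
    rcases cuttingSeq_eq_zero_or_one b (m + k) with hs | hs
    · refine ⟨x, y, x + x', y + y', ?_⟩
      have hs' : cuttingSeq b (n + k) = 1 := by rw [h, hs]; norm_num
      rw [← add_assoc, ← add_assoc, cutBasis_add_one_of_zero hL hb hs,
        cutBasis_add_one_of_one hL hb hs', h1, h2, h3, h4]
      exact ⟨⟨rfl, by module⟩, rfl, by module⟩
    · refine ⟨x + x', y + y', x', y', ?_⟩
      have hs' : cuttingSeq b (n + k) = 0 := by rw [h, hs]; norm_num
      rw [← add_assoc, ← add_assoc, cutBasis_add_one_of_one hL hb hs,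
        cutBasis_add_one_of_zero hL hb hs', h1, h2, h3, h4]
      exact ⟨⟨by module, rfl⟩, by module, rfl⟩
  | pred k ih =>
    obtain ⟨x, y, x', y', ⟨h1, h2⟩, h3, h4⟩ := ih
    have hmk : m + (-(k : ℤ) - 1) + 1 = m + -k := by ring
    have hnk : n + (-(k : ℤ) - 1) + 1 = n + -k := by ring
    rcases cuttingSeq_eq_zero_or_one b (m + (-k - 1)) with hs | hs
    · refine ⟨x, y, x' - x, y' - y, ?_⟩
      have hs' : cuttingSeq b (n + (-k - 1)) = 1 := by rw [h, hs]; norm_num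
      have h5 := cutBasis_add_one_of_zero hL hb hs
      have h6 := cutBasis_add_one_of_one hL hb hs'
      rw [hmk] at h5
      rw [hnk] at h6
      rw [h5] at h1 h2
      rw [h6] at h3 h4
      simp only at h1 h2 h3 h4
      refine ⟨⟨h1, ?_⟩, h3, ?_⟩
      · rw [h1] at h2
        rw [← sub_eq_iff_eq_add'.2 h2.symm]
        module
      · rw [h3] at h4
        rw [← sub_eq_iff_eq_add.2 h4.symm]
        module
    · refine ⟨x - x', y - y', x', y', ?_⟩
      have hs' : cuttingSeq b (n + (-k - 1)) = 0 := by rw [h, hs]; norm_num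
      have h5 := cutBasis_add_one_of_one hL hb hs
      have h6 := cutBasis_add_one_of_zero hL hb hs'
      rw [hmk] at h5
      rw [hnk] at h6
      rw [h5] at h1 h2
      rw [h6] at h3 h4
      simp only at h1 h2 h3 h4
      refine ⟨⟨?_, h2⟩, ?_, h4⟩
      · rw [h2] at h1
        rw [← sub_eq_iff_eq_add.2 h1.symm]
        module
      · rw [h4] at h3
        rw [← sub_eq_iff_eq_add'.2 h3.symm]
        module

/-- The square of `D` is used because its entries are positive, so it maps the bi-fan into itself
and acts on the cutting orbit as a shift by some `K`; the shift is not trivial since `λ² > 1`. -/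
lemma HyperbolicToralAut.exists_diagSame_sq (D : HyperbolicToralAut L) (hL : AxisFree L)
    (hb : b ∈ biFan L) : ∃ K : ℤ, K ≠ 0 ∧ ∀ m,
      DiagSame (D.mu ^ 2) (D.lam ^ 2) (cutBasis b m) (cutBasis b (m + K)) := by
  have hmu := pow_pos D.abs_mu_pos 2
  rw [sq_abs] at hmu
  have hlam1 : 1 < D.lam ^ 2 := by
    rw [← sq_abs]
    exact one_lt_pow₀ D.one_lt_abs_lam two_ne_zero
  have hlam : 0 < D.lam ^ 2 := by linarith
  have hmem : ∀ z, diagMap (D.mu ^ 2) (D.lam ^ 2) z ∈ L ↔ z ∈ L := by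
    intro z
    rw [← D.planeMap_mem_iff z, ← D.planeMap_mem_iff (D.planeMap z)]
    simp only [D.planeMap_apply, diagMap]
    ring_nf
  have hb' : (diagMap (D.mu ^ 2) (D.lam ^ 2) b.1, diagMap (D.mu ^ 2) (D.lam ^ 2) b.2) ∈ biFan L := by
    obtain ⟨h1, h2, h3, h4, h5⟩ := id hb
    refine ⟨mul_pos hmu h1, mul_pos hlam h2, mul_neg_of_pos_of_neg hmu h3, mul_pos hlam h4, ?_⟩
    apply le_antisymm
    · rw [Submodule.span_le]
      rintro x (rfl | rfl)
      · exact (hmem _).2 (biFan_fst_mem hb)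
      · exact (hmem _).2 (biFan_snd_mem hb)
    · intro z hz
      have hw : z = diagMap (D.mu ^ 2) (D.lam ^ 2) (diagMap (D.mu ^ 2)⁻¹ (D.lam ^ 2)⁻¹ z) := by
        ext
        · exact (mul_inv_cancel_left₀ hmu.ne' _).symm
        · exact (mul_inv_cancel_left₀ hlam.ne' _).symm
      rw [hw, hmem, mem_iff_of_biFan hb] at hz
      obtain ⟨m, n, hm, hn⟩ := hz
      rw [Plane.mem_span_pair]
      refine ⟨m, n, ?_, ?_⟩
      · rw [hw]
        simp only [diagMap] at hm ⊢
        rw [hm]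
        ring
      · rw [hw]
        simp only [diagMap] at hn ⊢
        rw [hn]
        ring
  obtain ⟨K, hK⟩ := exists_cutBasis_eq hL hb hb'
  refine ⟨K, ?_, fun m => ?_⟩
  · rintro rfl
    have h1 : D.lam ^ 2 * b.1.2 = b.1.2 := congrArg (fun b => b.1.2) hK
    have h2 := hb.2.1
    nlinarith
  · have h0 : DiagSame (D.mu ^ 2) (D.lam ^ 2) (cutBasis b 0) (cutBasis b K) := hK.symm
    have h1 := diagSame_cutBasis hL hb hmu hlam h0 m
    rwa [zero_add, add_comm] at h1

end Shift

/-! ### Symmetries of a 0-1 sequence up to complement -/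

/-- The shifts that preserve the sequence `s` or take it into `1 - s`. -/
def shiftGroup (s : ℤ → ℤ) : AddSubgroup ℤ where
  carrier := {d | (∀ k, s (k + d) = s k) ∨ ∀ k, s (k + d) = 1 - s k}
  zero_mem' := Or.inl (by simp)
  add_mem' := by
    rintro c d (hc | hc) (hd | hd)
    · exact Or.inl fun k => by rw [← add_assoc, hd, hc]
    · exact Or.inr fun k => by rw [← add_assoc, hd, hc]
    · exact Or.inr fun k => by rw [← add_assoc, hd, hc]
    · exact Or.inl fun k => by rw [← add_assoc, hd, hc]; ring
  neg_mem' := by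
    rintro d (hd | hd)
    · exact Or.inl fun k => by rw [← hd (k + -d)]; simp
    · exact Or.inr fun k => by
        have := hd (k + -d)
        rw [neg_add_cancel_right] at this
        omega

lemma mem_shiftGroup {s : ℤ → ℤ} {d : ℤ} :
    d ∈ shiftGroup s ↔ (∀ k, s (k + d) = s k) ∨ ∀ k, s (k + d) = 1 - s k := Iff.rfl

lemma basic_mem_shiftGroup {s : ℤ → ℤ} {N : ℕ} (h : IsBasicSemiPeriodOrPeriod s N) :
    (N : ℤ) ∈ shiftGroup s ∧ 0 < N := by
  rcases h with h | h
  · exact ⟨Or.inr h.1.2, h.1.1⟩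
  · exact ⟨Or.inl h.2.1.2, h.2.1.1⟩

lemma basic_le_of_mem_shiftGroup {s : ℤ → ℤ} {N : ℕ} (h : IsBasicSemiPeriodOrPeriod s N) {d : ℕ}
    (hd : 0 < d) (hmem : (d : ℤ) ∈ shiftGroup s) : N ≤ d := by
  rcases hmem with hs | hs
  · rcases h with h | h
    · by_contra! hlt
      -- A period `d` shorter than the least semi-period `N` would leave the smaller semi-period `N
      -- - d`.
      have h1 : IsSemiPeriod s (N - d) := by
        refine ⟨by omega, fun k => ?_⟩
        rw [← h.1.2 k, ← hs, Nat.cast_sub hlt.le]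
        congr 1
        ring
      have := h.2 h1
      omega
    · exact h.2.2 ⟨hd, hs⟩
  · rcases h with h | h
    · exact h.2 ⟨hd, hs⟩
    · exact absurd ⟨d, hd, hs⟩ h.1

/-- As the least positive element of `shiftGroup`, `N` generates it, and `0, …, N - 1` represent its
cosets. -/
lemma existsUnique_sub_mem_shiftGroup {s : ℤ → ℤ} {N : ℕ} (h : IsBasicSemiPeriodOrPeriod s N)
    (n : ℤ) : ∃! i : Fin N, n - (i : ℕ) ∈ shiftGroup s := by
  obtain ⟨hN, hpos⟩ := basic_mem_shiftGroup h
  have h0 := Int.emod_nonneg n (b := N) (by omega)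
  have h1 := Int.emod_lt_of_pos n (b := N) (by omega)
  refine ⟨⟨(n % N).toNat, by omega⟩, ?_, ?_⟩
  · simp only [Int.toNat_of_nonneg h0]
    have : n - n % N = (n / N) • (N : ℤ) := by
      have := Int.mul_ediv_add_emod n N
      rw [smul_eq_mul]
      linarith
    rw [this]
    exact zsmul_mem hN _
  · have key : ∀ i j : ℕ, i < N → j < N → n - i ∈ shiftGroup s → n - j ∈ shiftGroup s → j ≤ i := by
      intro i j hi hj hi' hj'
      by_contra! hlt
      have h2 := sub_mem hi' hj'
      have h3 : n - i - (n - j) = ((j - i : ℕ) : ℤ) := by omega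
      rw [h3] at h2
      have := basic_le_of_mem_shiftGroup h (by omega) h2
      omega
    intro j hj
    have h2 : n - ((n % N).toNat : ℕ) ∈ shiftGroup s := by
      simp only [Int.toNat_of_nonneg h0]
      have : n - n % N = (n / N) • (N : ℤ) := by
        have := Int.mul_ediv_add_emod n N
        rw [smul_eq_mul]
        linarith
      rw [this]
      exact zsmul_mem hN _
    apply Fin.ext
    exact le_antisymm (key _ _ (by omega) j.2 h2 hj) (key _ _ j.2 (by omega) hj h2)

section Shift

variable {L : Submodule ℤ Plane} {b b' : Plane × Plane} {α β : ℝ}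

lemma exists_isBasicSemiPeriodOrPeriod (D : HyperbolicToralAut L) (hL : AxisFree L)
    (hb : b ∈ biFan L) : ∃ N, IsBasicSemiPeriodOrPeriod (cuttingSeq b) N := by
  classical
  obtain ⟨K, hK0, hK⟩ := D.exists_diagSame_sq hL hb
  have hmu : 0 < D.mu ^ 2 := by have := D.mu_ne_zero; positivity
  have hlam : 0 < D.lam ^ 2 := by have := D.lam_ne_zero; positivity
  have hper : ∀ k, cuttingSeq b (k + K) = cuttingSeq b k := fun k => by
    have := cuttingSeq_of_diagSame hL hb hmu hlam (hK k) 0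
    simpa using this
  have hex : ∃ M, IsPeriod (cuttingSeq b) M := by
    refine ⟨K.natAbs, Int.natAbs_pos.2 hK0, fun k => ?_⟩
    rcases Int.natAbs_eq K with h | h
    · rw [← h, hper]
    · rw [← hper, show (K.natAbs : ℤ) = -K by omega, neg_add_cancel_right]
  have least : ∀ p : ℕ → Prop, (∃ n, p n) → ∃ n, IsLeast {n | p n} n := fun p hp =>
    ⟨Nat.find hp, Nat.find_spec hp, fun m hm => Nat.find_min' hp hm⟩
  by_cases hsemi : ∃ M, IsSemiPeriod (cuttingSeq b) M
  · obtain ⟨N, hN⟩ := least _ hsemi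
    exact ⟨N, Or.inl hN⟩
  · obtain ⟨N, hN⟩ := least _ hex
    exact ⟨N, Or.inr ⟨hsemi, hN⟩⟩

/-- Two pairs satisfying the same eigenvalue relation are proportional. -/
lemma eq_div_mul_of_relation {r x y u v u' v' : ℝ} (hy : y ≠ 0) (hu : u ≠ 0)
    (h : r * u = x * u + y * v) (h' : r * u' = x * u' + y * v') : v' = u' / u * v := by
  apply mul_left_cancel₀ hy
  rw [div_mul_eq_mul_div, mul_div_assoc', eq_div_iff hu]
  linear_combination u' * h - u * h'

/-- From left to right, a diagonal map carries one cutting orbit along the other. Conversely, if the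
sequences seen from `m` and `n` agree, the shift by `K` has the same integral coordinates at both
places. Since this shift is also `diag(μ², λ²)`, both bases satisfy the same relations `μ² e₁ = x e₁
+ y f₁` and `λ² e₂ = x e₂ + y f₂` with `y ≠ 0`, which fix the ratio of `f` to `e` in each
coordinate. In the complementary case `e` and `f` change places. -/
lemma diagRel_cutBasis_iff (D : HyperbolicToralAut L) (hL : AxisFree L) (hb : b ∈ biFan L)
    (m n : ℤ) : DiagRel (cutBasis b m) (cutBasis b n) ↔ n - m ∈ shiftGroup (cuttingSeq b) := by
  rw [mem_shiftGroup]
  constructor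
  · rintro ⟨α, β, hα, hβ, h | h⟩
    · refine Or.inl fun k => ?_
      have := cuttingSeq_of_diagSame hL hb hα hβ h (k - m)
      rwa [add_sub_cancel, show n + (k - m) = k + (n - m) by ring] at this
    · refine Or.inr fun k => ?_
      have := cuttingSeq_of_diagFlip hL hb hα hβ h (k - m)
      rwa [add_sub_cancel, show n + (k - m) = k + (n - m) by ring] at this
  · obtain ⟨K, -, hK⟩ := D.exists_diagSame_sq hL hb
    have hne : D.mu ^ 2 ≠ D.lam ^ 2 := by
      rw [← sq_abs, ← sq_abs D.lam]
      have h1 := D.abs_mu_pos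
      have h2 := D.abs_mu_lt_one
      have h3 := D.one_lt_abs_lam
      nlinarith
    obtain ⟨p1, p2, p3, p4, -⟩ := cutBasis_mem hL hb m
    obtain ⟨q1, q2, q3, q4, -⟩ := cutBasis_mem hL hb n
    have hKm := congrArg (fun b => b.1) (hK m)
    have hKn1 := congrArg (fun b => b.1) (hK n)
    have hKn2 := congrArg (fun b => b.2) (hK n)
    simp only at hKm hKn1 hKn2
    have fst_eq : ∀ {z c d : Plane} {x y : ℤ}, diagMap (D.mu ^ 2) (D.lam ^ 2) z = x • c + y • d →
        D.mu ^ 2 * z.1 = x * c.1 + y * d.1 ∧ D.lam ^ 2 * z.2 = x * c.2 + y * d.2 := by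
      intro z c d x y h
      constructor
      · have := congrArg Prod.fst h
        rwa [Prod.fst_add, Prod.smul_fst, Prod.smul_fst, zsmul_eq_mul, zsmul_eq_mul] at this
      · have := congrArg Prod.snd h
        rwa [Prod.snd_add, Prod.smul_snd, Prod.smul_snd, zsmul_eq_mul, zsmul_eq_mul] at this
    have hy0 : ∀ {x y : ℤ}, D.mu ^ 2 * (cutBasis b m).1.1 =
        x * (cutBasis b m).1.1 + y * (cutBasis b m).2.1 →
        D.lam ^ 2 * (cutBasis b m).1.2 =
        x * (cutBasis b m).1.2 + y * (cutBasis b m).2.2 → (y : ℝ) ≠ 0 := by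
      intro x y h1 h2 h0
      rw [h0, zero_mul, add_zero] at h1 h2
      exact hne ((mul_right_cancel₀ p1.ne' h1).trans (mul_right_cancel₀ p2.ne' h2).symm)
    rintro (h | h)
    · obtain ⟨x, y, _, _, hxy⟩ := exists_common_coords hL hb (m := m) (n := n) (fun k => by
        rw [← h (m + k)]; congr 1; ring) K
      obtain ⟨h1, h2⟩ := fst_eq (hKm.symm.trans (hxy m (Or.inl rfl)).1)
      obtain ⟨h3, h4⟩ := fst_eq (hKn1.symm.trans (hxy n (Or.inr rfl)).1)
      have hy := hy0 h1 h2
      refine ⟨(cutBasis b n).1.1 / (cutBasis b m).1.1, (cutBasis b n).1.2 / (cutBasis b m).1.2,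
        div_pos q1 p1, div_pos q2 p2, Or.inl ?_⟩
      refine Prod.ext (Prod.ext ?_ ?_) (Prod.ext ?_ ?_)
      · exact (div_mul_cancel₀ _ p1.ne').symm
      · exact (div_mul_cancel₀ _ p2.ne').symm
      · exact eq_div_mul_of_relation hy p1.ne' h1 h3
      · exact eq_div_mul_of_relation hy p2.ne' h2 h4
    · obtain ⟨x, y, _, _, ⟨hm1, -⟩, hn1, -⟩ := exists_common_coords_flip hL hb (m := m) (n := n)
        (fun k => by rw [← h (m + k)]; congr 1; ring) K
      obtain ⟨h1, h2⟩ := fst_eq (hKm.symm.trans hm1)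
      obtain ⟨h3, h4⟩ := fst_eq (hKn2.symm.trans hn1)
      have hy := hy0 h1 h2
      refine ⟨-((cutBasis b n).2.1 / (cutBasis b m).1.1), (cutBasis b n).2.2 / (cutBasis b m).1.2,
        neg_pos.2 (div_neg_of_neg_of_pos q3 p1), div_pos q4 p2, Or.inr ?_⟩
      rw [DiagFlip, neg_neg]
      refine Prod.ext (Prod.ext ?_ ?_) (Prod.ext ?_ ?_)
      · exact eq_div_mul_of_relation hy p1.ne' h1 h3
      · exact eq_div_mul_of_relation hy p2.ne' h2 h4
      · exact (div_mul_cancel₀ _ p1.ne').symm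
      · exact (div_mul_cancel₀ _ p2.ne').symm

end Shift

/-! ### Bi-partitions tile the torus -/

namespace BiPartition

variable {L : Submodule ℤ Plane} (P : BiPartition L)

/-- The basis of the bi-fan that belongs to a bi-partition. -/
def basis : Plane × Plane := ((P.v, P.p), (-P.u, P.q))

lemma basis_mem : P.basis ∈ biFan L :=
  ⟨P.v_pos, P.p_pos, neg_neg_of_pos P.u_pos, P.q_pos, P.span_eq⟩

/-- The widths of the two rectangles. -/
def width : Fin 2 → ℝ := ![P.u, P.v]

/-- The heights of the two rectangles. -/
def height : Fin 2 → ℝ := ![P.p, P.q]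

lemma height_pos (i : Fin 2) : 0 < P.height i := by
  fin_cases i
  · exact P.p_pos
  · exact P.q_pos

lemma right_sub_left (i : Fin 2) : P.right i - P.left i = P.width i := by
  fin_cases i <;> simp [right, left, width]

lemma top_sub_bottom (i : Fin 2) : P.top i - P.bottom i = P.height i := by
  fin_cases i <;> simp [top, bottom, height]

lemma left_lt_right (i : Fin 2) : P.left i < P.right i := by
  have := P.u_pos
  have := P.v_pos
  fin_cases i <;> simpa [right, left]

lemma bottom_lt_top (i : Fin 2) : P.bottom i < P.top i := by
  have := P.p_pos
  have := P.q_pos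
  fin_cases i <;> simpa [top, bottom]

lemma interior_rect (i : Fin 2) :
    interior (P.rect i) = Ioo (P.left i) (P.right i) ×ˢ Ioo (P.bottom i) (P.top i) := by
  rw [rect, interior_prod_eq, interior_Icc, interior_Icc]

/-- The segment that projects onto the horizontal spine. -/
def hSegment : Set Plane := Icc (P.w.1 - P.v) (P.w.1 + P.u) ×ˢ {P.w.2}

/-- The segment that projects onto the vertical spine. -/
def vSegment : Set Plane := {P.w.1} ×ˢ Icc P.w.2 (P.w.2 + (P.p + P.q))

lemma mkQ_mem_image {z l : Plane} {S : Set Plane} (hl : l ∈ L) (h : z + l ∈ S) :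
    L.mkQ z ∈ L.mkQ '' S :=
  ⟨z + l, h, mkQ_eq_iff.2 (by simpa using hl)⟩

/-- The top side of `R₁` is brought back to the base by `-[v, p]`, that of `R₂` by `-[-u, q]`. -/
lemma horizontalSpine_eq : P.horizontalSpine = L.mkQ '' P.hSegment := by
  have hu := P.u_pos
  have hv := P.v_pos
  apply Subset.antisymm
  · rintro _ ⟨z, hz, rfl⟩
    obtain ⟨i, ⟨h1, h2⟩, h3⟩ := mem_iUnion.1 hz
    fin_cases i <;>
      simp only [left, right, bottom, top, Fin.zero_eta, Fin.mk_one, Matrix.cons_val_zero,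
        Matrix.cons_val_one, Matrix.cons_val_fin_one, mem_insert_iff, mem_singleton_iff] at h1 h2 h3
    · rcases h3 with h3 | h3
      · exact ⟨z, ⟨⟨by linarith, by linarith⟩, h3⟩, rfl⟩
      · refine mkQ_mem_image (L.neg_mem (biFan_fst_mem P.basis_mem)) ?_
        refine ⟨⟨?_, ?_⟩, ?_⟩ <;> simp only [basis, Prod.fst_add, Prod.snd_add, Prod.fst_neg,
          Prod.snd_neg, mem_singleton_iff] <;> linarith
    · rcases h3 with h3 | h3
      · exact ⟨z, ⟨⟨by linarith, by linarith⟩, h3⟩, rfl⟩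
      · refine mkQ_mem_image (L.neg_mem (biFan_snd_mem P.basis_mem)) ?_
        refine ⟨⟨?_, ?_⟩, ?_⟩ <;> simp only [basis, Prod.fst_add, Prod.snd_add, Prod.fst_neg,
          Prod.snd_neg, mem_singleton_iff] <;> linarith
  · apply image_mono
    rintro z ⟨⟨h1, h2⟩, h3⟩
    rw [mem_singleton_iff] at h3
    rw [mem_iUnion]
    rcases le_total P.w.1 z.1 with h | h
    · exact ⟨0, ⟨h, h2⟩, Or.inl h3⟩
    · exact ⟨1, ⟨h1, h⟩, Or.inl h3⟩

/-- The right side of `R₁` is moved onto the central vertical line by `[-u, q]`, the left side of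
`R₂` by `[v, p]`; they cover its parts above `q` and above `p`. -/
lemma verticalSpine_eq : P.verticalSpine = L.mkQ '' P.vSegment := by
  have hp := P.p_pos
  have hq := P.q_pos
  apply Subset.antisymm
  · rintro _ ⟨z, hz, rfl⟩
    obtain ⟨i, h3, ⟨h1, h2⟩⟩ := mem_iUnion.1 hz
    fin_cases i <;>
      simp only [left, right, bottom, top, Fin.zero_eta, Fin.mk_one, Matrix.cons_val_zero,
        Matrix.cons_val_one, Matrix.cons_val_fin_one, mem_insert_iff, mem_singleton_iff] at h1 h2 h3
    · rcases h3 with h3 | h3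
      · exact ⟨z, ⟨h3, by linarith, by linarith⟩, rfl⟩
      · refine mkQ_mem_image (biFan_snd_mem P.basis_mem) ?_
        refine ⟨?_, ?_, ?_⟩ <;> simp only [basis, Prod.fst_add, Prod.snd_add,
          mem_singleton_iff] <;> linarith
    · rcases h3 with h3 | h3
      · refine mkQ_mem_image (biFan_fst_mem P.basis_mem) ?_
        refine ⟨?_, ?_, ?_⟩ <;> simp only [basis, Prod.fst_add, Prod.snd_add,
          mem_singleton_iff] <;> linarith
      · exact ⟨z, ⟨h3, by linarith, by linarith⟩, rfl⟩
  · rintro _ ⟨z, ⟨h1, h2, h3⟩, rfl⟩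
    rw [mem_singleton_iff] at h1
    rcases le_total z.2 (P.w.2 + P.q) with h | h
    · exact ⟨z, mem_iUnion.2 ⟨1, Or.inr h1, h2, h⟩, rfl⟩
    · refine mkQ_mem_image (L.neg_mem (biFan_snd_mem P.basis_mem)) (mem_iUnion.2 ⟨0, Or.inr ?_, ?_, ?_⟩)
      · simp [basis, h1, right]
      · simp only [basis, Prod.snd_add, Prod.snd_neg, bottom, Matrix.cons_val_zero]
        linarith
      · simp only [basis, Prod.snd_add, Prod.snd_neg, top, Matrix.cons_val_zero]
        linarith

/-- A nonzero lattice vector is long in at least one of the two directions. -/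
lemma lattice_cases {d : Plane} (hd : d ∈ L) : d = 0 ∨ P.u + P.v ≤ d.1 ∨ d.1 ≤ -(P.u + P.v) ∨
    P.p + P.q ≤ d.2 ∨ d.2 ≤ -(P.p + P.q) ∨ (P.v ≤ d.1 ∧ P.p ≤ d.2) ∨ (d.1 ≤ -P.v ∧ d.2 ≤ -P.p) ∨
    (d.1 ≤ -P.u ∧ P.q ≤ d.2) ∨ (P.u ≤ d.1 ∧ d.2 ≤ -P.q) := by
  obtain ⟨m, n, h1, h2⟩ := (mem_iff_of_biFan P.basis_mem).1 hd
  simp only [basis] at h1 h2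
  have hu := P.u_pos
  have hv := P.v_pos
  have hp := P.p_pos
  have hq := P.q_pos
  have cast_le : ∀ k : ℤ, k < 0 → (k : ℝ) ≤ -1 := fun k hk => by
    have : k ≤ -1 := by omega
    exact_mod_cast this
  have le_cast : ∀ k : ℤ, 0 < k → (1 : ℝ) ≤ k := fun k hk => by
    have : 1 ≤ k := by omega
    exact_mod_cast this
  rcases lt_trichotomy m 0 with hm | hm | hm <;> rcases lt_trichotomy n 0 with hn | hn | hn
  · have := cast_le m hm
    have := cast_le n hn
    right; right; right; right; left
    nlinarith
  · have := cast_le m hm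
    rw [hn, Int.cast_zero, zero_mul, add_zero] at h1 h2
    right; right; right; right; right; right; left
    constructor <;> nlinarith
  · have := cast_le m hm
    have := le_cast n hn
    right; right; left
    nlinarith
  · have := cast_le n hn
    rw [hm, Int.cast_zero, zero_mul, zero_add] at h1 h2
    right; right; right; right; right; right; right; right
    constructor <;> nlinarith
  · left
    ext <;> simp [h1, h2, hm, hn]
  · have := le_cast n hn
    rw [hm, Int.cast_zero, zero_mul, zero_add] at h1 h2
    right; right; right; right; right; right; right; left
    constructor <;> nlinarith
  · have := le_cast m hm
    have := cast_le n hn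
    right; left
    nlinarith
  · have := le_cast m hm
    rw [hn, Int.cast_zero, zero_mul, add_zero] at h1 h2
    right; right; right; right; right; left
    constructor <;> nlinarith
  · have := le_cast m hm
    have := le_cast n hn
    right; right; right; left
    nlinarith

/-- The half-open rectangles. -/
def halfOpen (i : Fin 2) : Set Plane := Ico (P.left i) (P.right i) ×ˢ Ico (P.bottom i) (P.top i)

lemma interior_rect_subset_halfOpen (i : Fin 2) : interior (P.rect i) ⊆ P.halfOpen i := by
  rw [interior_rect]
  exact prod_mono Ioo_subset_Ico_self Ioo_subset_Ico_self

/-- Two points of the half-open rectangles are too close for their difference to satisfy any of the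
alternatives of `lattice_cases` other than 0. -/
lemma halfOpen_unique {i j : Fin 2} {z l l' : Plane} (hl : l ∈ L) (hl' : l' ∈ L)
    (h : z - l ∈ P.halfOpen i) (h' : z - l' ∈ P.halfOpen j) : i = j ∧ l = l' := by
  have hu := P.u_pos
  have hv := P.v_pos
  have hp := P.p_pos
  have hq := P.q_pos
  have hcases := P.lattice_cases (L.sub_mem hl hl')
  rw [sub_eq_zero] at hcases
  obtain ⟨⟨h1, h2⟩, h3, h4⟩ := h
  obtain ⟨⟨h1', h2'⟩, h3', h4'⟩ := h'
  fin_cases i <;> fin_cases j <;>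
    simp only [left, right, bottom, top, Fin.zero_eta, Fin.mk_one, Matrix.cons_val_zero,
      Matrix.cons_val_one, Matrix.cons_val_fin_one, Prod.fst_sub, Prod.snd_sub]
      at h1 h2 h3 h4 h1' h2' h3' h4' hcases ⊢
  · refine ⟨trivial, ?_⟩
    rcases hcases with h | h | h | h | h | h | h | h | h
    · exact h
    all_goals exact absurd h (by linarith)
  · exfalso
    rcases hcases with h | h | h | h | h | h | h | h | h
    · rw [h] at h1
      linarith
    all_goals exact absurd h (by linarith)
  · exfalso
    rcases hcases with h | h | h | h | h | h | h | h | h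
    · rw [h] at h2
      linarith
    all_goals exact absurd h (by linarith)
  · refine ⟨trivial, ?_⟩
    rcases hcases with h | h | h | h | h | h | h | h | h
    · exact h
    all_goals exact absurd h (by linarith)

/-- The two rectangles are the towers over an exchange of the intervals of the base `[-v, u)`.
Within the strip over this base, a point is moved up or down by `e` or `f`, whichever keeps it in
the strip. Each move changes the height by at least `δ`, so the point ends in one of the towers. -/
lemma exists_halfOpen (z : Plane) : ∃ i, ∃ l ∈ L, z - l ∈ P.halfOpen i := by
  have hu := P.u_pos
  have hv := P.v_pos
  have hp := P.p_pos
  have hq := P.q_pos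
  have he := biFan_fst_mem P.basis_mem
  have hf := biFan_snd_mem P.basis_mem
  obtain ⟨δ, hδ, hδp, hδq⟩ : ∃ δ > 0, δ ≤ P.p ∧ δ ≤ P.q :=
    ⟨min P.p P.q, lt_min hp hq, min_le_left _ _, min_le_right _ _⟩
  have up : ∀ n : ℕ, ∀ y : Plane, -P.v ≤ y.1 → y.1 < P.u → -(n * δ) ≤ y.2 →
      ∃ l ∈ L, -P.v ≤ (y + l).1 ∧ (y + l).1 < P.u ∧ 0 ≤ (y + l).2 := by
    intro n
    induction n with
    | zero =>
      intro y h1 h2 h3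
      exact ⟨0, L.zero_mem, by simpa using h1, by simpa using h2, by simpa using h3⟩
    | succ n ih =>
      intro y h1 h2 h3
      push_cast at h3
      rcases lt_or_ge y.1 (P.u - P.v) with h | h
      · obtain ⟨l, hl, hh⟩ := ih (y + P.basis.1)
          (by simp only [basis, Prod.fst_add]; linarith)
          (by simp only [basis, Prod.fst_add]; linarith)
          (by simp only [basis, Prod.snd_add]; linarith)
        exact ⟨P.basis.1 + l, L.add_mem he hl, by rwa [← add_assoc]⟩
      · obtain ⟨l, hl, hh⟩ := ih (y + P.basis.2)
          (by simp only [basis, Prod.fst_add]; linarith)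
          (by simp only [basis, Prod.fst_add]; linarith)
          (by simp only [basis, Prod.snd_add]; linarith)
        exact ⟨P.basis.2 + l, L.add_mem hf hl, by rwa [← add_assoc]⟩
  have down : ∀ n : ℕ, ∀ y : Plane, -P.v ≤ y.1 → y.1 < P.u → 0 ≤ y.2 → y.2 < n * δ →
      ∃ i, ∃ l ∈ L, P.w + y - l ∈ P.halfOpen i := by
    intro n
    induction n with
    | zero =>
      intro y h1 h2 h3 h4
      simp only [CharP.cast_eq_zero, zero_mul] at h4
      linarith
    | succ n ih =>
      intro y h1 h2 h3 h4
      push_cast at h4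
      rcases lt_or_ge y.1 0 with h | h
      · rcases lt_or_ge y.2 P.q with h' | h'
        · refine ⟨1, 0, L.zero_mem, ⟨?_, ?_⟩, ?_, ?_⟩ <;>
            simp only [sub_zero, Prod.fst_add, Prod.snd_add, left, right, bottom, top,
              Matrix.cons_val_one, Matrix.cons_val_fin_one] <;> linarith
        · obtain ⟨i, l, hl, hh⟩ := ih (y - P.basis.2)
            (by simp only [basis, Prod.fst_sub]; linarith)
            (by simp only [basis, Prod.fst_sub]; linarith)
            (by simp only [basis, Prod.snd_sub]; linarith)
            (by simp only [basis, Prod.snd_sub]; linarith)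
          exact ⟨i, P.basis.2 + l, L.add_mem hf hl, by convert hh using 1; abel⟩
      · rcases lt_or_ge y.2 P.p with h' | h'
        · refine ⟨0, 0, L.zero_mem, ⟨?_, ?_⟩, ?_, ?_⟩ <;>
            simp only [sub_zero, Prod.fst_add, Prod.snd_add, left, right, bottom, top,
              Matrix.cons_val_zero] <;> linarith
        · obtain ⟨i, l, hl, hh⟩ := ih (y - P.basis.1)
            (by simp only [basis, Prod.fst_sub]; linarith)
            (by simp only [basis, Prod.fst_sub]; linarith)
            (by simp only [basis, Prod.snd_sub]; linarith)
            (by simp only [basis, Prod.snd_sub]; linarith)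
          exact ⟨i, P.basis.1 + l, L.add_mem he hl, by convert hh using 1; abel⟩
  -- Subtracting `k` times `[v, p]` brings the abscissa relative to the corner into `[-v, 0)`,
  -- inside the strip.
  set k : ℤ := ⌊(z - P.w).1 / P.v⌋ + 1 with hk
  have hk1 : (k - 1 : ℝ) ≤ (z - P.w).1 / P.v := by
    rw [hk]; push_cast; linarith [Int.floor_le ((z - P.w).1 / P.v)]
  have hk2 : (z - P.w).1 / P.v < k := by
    rw [hk]; push_cast; exact Int.lt_floor_add_one _
  rw [le_div_iff₀ hv] at hk1
  rw [div_lt_iff₀ hv] at hk2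
  have hke : k • P.basis.1 ∈ L := L.smul_mem _ he
  have hke1 : (z - P.w - k • P.basis.1).1 = (z - P.w).1 - k * P.v := by
    rw [Prod.fst_sub (z - P.w), Prod.smul_fst, zsmul_eq_mul]
    rfl
  obtain ⟨N, hN⟩ := exists_nat_gt (-(z - P.w - k • P.basis.1).2 / δ)
  rw [div_lt_iff₀ hδ] at hN
  obtain ⟨l, hl, h1, h2, h3⟩ := up N (z - P.w - k • P.basis.1) (by rw [hke1]; linarith)
    (by rw [hke1]; linarith) (by linarith)
  obtain ⟨M, hM⟩ := exists_nat_gt ((z - P.w - k • P.basis.1 + l).2 / δ)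
  rw [div_lt_iff₀ hδ] at hM
  obtain ⟨i, l', hl', hh⟩ := down M _ h1 h2 h3 hM
  exact ⟨i, k • P.basis.1 - l + l', L.add_mem (L.sub_mem hke hl) hl', by convert hh using 1; abel⟩

lemma mkQ_notMem_verticalSpine {i : Fin 2} {z : Plane} (hz : z ∈ interior (P.rect i)) :
    L.mkQ z ∉ P.verticalSpine := by
  rw [verticalSpine_eq]
  rintro ⟨y, ⟨hy1, hy2, hy3⟩, hyz⟩
  have hu := P.u_pos
  have hv := P.v_pos
  have hp := P.p_pos
  have hq := P.q_pos
  have hcases := P.lattice_cases (mkQ_eq_iff.1 hyz)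
  rw [sub_eq_zero] at hcases
  rw [mem_singleton_iff] at hy1
  rw [interior_rect] at hz
  obtain ⟨⟨h1, h2⟩, h3, h4⟩ := hz
  fin_cases i <;>
    simp only [left, right, bottom, top, Fin.zero_eta, Fin.mk_one, Matrix.cons_val_zero,
      Matrix.cons_val_one, Matrix.cons_val_fin_one, Prod.fst_sub, Prod.snd_sub]
      at h1 h2 h3 h4 hcases
  all_goals
    rcases hcases with h | h | h | h | h | h | h | h | h
    · rw [h] at hy1
      linarith
    all_goals exact absurd h (by linarith)

lemma mkQ_notMem_horizontalSpine {i : Fin 2} {z : Plane} (hz : z ∈ interior (P.rect i)) :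
    L.mkQ z ∉ P.horizontalSpine := by
  rw [horizontalSpine_eq]
  rintro ⟨y, ⟨⟨hy2, hy3⟩, hy1⟩, hyz⟩
  have hu := P.u_pos
  have hv := P.v_pos
  have hp := P.p_pos
  have hq := P.q_pos
  have hcases := P.lattice_cases (mkQ_eq_iff.1 hyz)
  rw [sub_eq_zero] at hcases
  rw [mem_singleton_iff] at hy1
  rw [interior_rect] at hz
  obtain ⟨⟨h1, h2⟩, h3, h4⟩ := hz
  fin_cases i <;>
    simp only [left, right, bottom, top, Fin.zero_eta, Fin.mk_one, Matrix.cons_val_zero,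
      Matrix.cons_val_one, Matrix.cons_val_fin_one, Prod.fst_sub, Prod.snd_sub]
      at h1 h2 h3 h4 hcases
  all_goals
    rcases hcases with h | h | h | h | h | h | h | h | h
    · rw [h] at hy1
      linarith
    all_goals exact absurd h (by linarith)

end BiPartition

/-! ### Equivalence of bi-partitions and diagonal maps -/

section Boxes

lemma image_affine_Ioo {α : ℝ} (hα : α ≠ 0) (c : ℝ) {a b : ℝ} (hab : a < b) :
    ∃ a' b', a' < b' ∧ b' - a' = |α| * (b - a) ∧
      (fun x => α * x + c) '' Ioo a b = Ioo a' b' ∧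
      (a' = α * a + c ∨ a' = α * b + c) ∧ (b' = α * a + c ∨ b' = α * b + c) := by
  rcases lt_or_gt_of_ne hα with h | h
  · refine ⟨α * b + c, α * a + c, by nlinarith, by rw [abs_of_neg h]; ring, ?_, Or.inr rfl,
      Or.inl rfl⟩
    ext y
    constructor
    · rintro ⟨x, ⟨h1, h2⟩, rfl⟩
      exact ⟨by simp only; nlinarith, by simp only; nlinarith⟩
    · rintro ⟨h1, h2⟩
      refine ⟨(y - c) / α, ⟨?_, ?_⟩, by field_simp; ring⟩
      · rw [lt_div_iff_of_neg h]; linarith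
      · rw [div_lt_iff_of_neg h]; linarith
  · refine ⟨α * a + c, α * b + c, by nlinarith, by rw [abs_of_pos h]; ring, ?_, Or.inl rfl,
      Or.inr rfl⟩
    ext y
    constructor
    · rintro ⟨x, ⟨h1, h2⟩, rfl⟩
      exact ⟨by simp only; nlinarith, by simp only; nlinarith⟩
    · rintro ⟨h1, h2⟩
      refine ⟨(y - c) / α, ⟨?_, ?_⟩, by field_simp; ring⟩
      · rw [lt_div_iff₀ h]; linarith
      · rw [div_lt_iff₀ h]; linarith

lemma Ioo_inj {a b a' b' : ℝ} (h : a < b) (h' : a' < b') (heq : Ioo a b = Ioo a' b') :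
    a = a' ∧ b = b' := by
  have h1 := congrArg sInf heq
  have h2 := congrArg sSup heq
  rw [csInf_Ioo h, csInf_Ioo h'] at h1
  rw [csSup_Ioo h, csSup_Ioo h'] at h2
  exact ⟨h1, h2⟩

end Boxes

namespace BiPartition

variable {L : Submodule ℤ Plane}

/-- The image is an open box, connected and covered by the pairwise disjoint open translates of the
interior of the `j`-th rectangle of `Q`, hence contained in one of them. It fills that translate,
because distinct points of one translate are never congruent modulo `L`. Equal boxes have equal
sides. -/
lemma size_eq_of_image_tile {P Q : BiPartition L} {i j : Fin 2} {α β : ℝ} {c : Plane}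
    (hα : α ≠ 0) (hβ : β ≠ 0)
    (h : L.mkQ '' ((fun z : Plane => ((α * z.1 + c.1, β * z.2 + c.2) : Plane)) ''
      interior (P.rect i)) = Q.tile j) :
    Q.width j = |α| * P.width i ∧ Q.height j = |β| * P.height i := by
  obtain ⟨a, b, hab, hw, hI, -⟩ := image_affine_Ioo hα c.1 (P.left_lt_right i)
  obtain ⟨a', b', hab', hw', hI', -⟩ := image_affine_Ioo hβ c.2 (P.bottom_lt_top i)
  have himg : (fun z : Plane => ((α * z.1 + c.1, β * z.2 + c.2) : Plane)) ''
      interior (P.rect i) = Ioo a b ×ˢ Ioo a' b' := by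
    rw [P.interior_rect, ← hI, ← hI', prod_image_image_eq]
  rw [himg] at h
  have hunique : ∀ {z l l' : Plane}, l ∈ L → l' ∈ L → z - l ∈ interior (Q.rect j) →
      z - l' ∈ interior (Q.rect j) → l = l' := fun hl hl' h1 h2 =>
    (Q.halfOpen_unique hl hl' (Q.interior_rect_subset_halfOpen j h1)
      (Q.interior_rect_subset_halfOpen j h2)).2
  have hcover : ∀ z ∈ Ioo a b ×ˢ Ioo a' b', ∃ l ∈ L, z - l ∈ interior (Q.rect j) := by
    intro z hz
    have : L.mkQ z ∈ Q.tile j := h ▸ mem_image_of_mem _ hz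
    obtain ⟨y, hy, hyz⟩ := this
    exact ⟨z - y, mkQ_eq_iff.1 hyz.symm, by simpa using hy⟩
  have hne : (Ioo a b ×ˢ Ioo a' b').Nonempty := (nonempty_Ioo.2 hab).prod (nonempty_Ioo.2 hab')
  obtain ⟨z₀, hz₀⟩ := hne
  obtain ⟨l, hl, hz₀l⟩ := hcover z₀ hz₀
  have hopen : ∀ l : Plane, IsOpen ((fun z => z - l) ⁻¹' interior (Q.rect j)) := fun l =>
    isOpen_interior.preimage (by fun_prop)
  have hsub : Ioo a b ×ˢ Ioo a' b' ⊆ (fun z => z - l) ⁻¹' interior (Q.rect j) := by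
    refine (isPreconnected_Ioo.prod isPreconnected_Ioo).subset_left_of_subset_union (hopen l)
      (v := ⋃ l' ∈ {l' | l' ∈ L ∧ l' ≠ l}, (fun z => z - l') ⁻¹' interior (Q.rect j))
      (isOpen_biUnion fun l' _ => hopen l') ?_ ?_ ⟨z₀, hz₀, hz₀l⟩
    · rw [disjoint_left]
      intro z hz hz'
      obtain ⟨l', ⟨hl', hne⟩, hz''⟩ := mem_iUnion₂.1 hz'
      exact hne (hunique hl' hl hz'' hz)
    · intro z hz
      obtain ⟨l', hl', hz'⟩ := hcover z hz
      by_cases heq : l' = l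
      · exact Or.inl (heq ▸ hz')
      · exact Or.inr (mem_iUnion₂.2 ⟨l', ⟨hl', heq⟩, hz'⟩)
  have heq : Ioo a b ×ˢ Ioo a' b' =
      Ioo (Q.left j + l.1) (Q.right j + l.1) ×ˢ Ioo (Q.bottom j + l.2) (Q.top j + l.2) := by
    have hpre : (fun z => z - l) ⁻¹' interior (Q.rect j) =
        Ioo (Q.left j + l.1) (Q.right j + l.1) ×ˢ Ioo (Q.bottom j + l.2) (Q.top j + l.2) := by
      rw [Q.interior_rect]
      ext z
      simp only [mem_preimage, mem_prod, mem_Ioo, Prod.fst_sub, Prod.snd_sub, lt_sub_iff_add_lt,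
        sub_lt_iff_lt_add]
    rw [← hpre]
    refine Subset.antisymm hsub fun z hz => ?_
    have : L.mkQ z ∈ L.mkQ '' (Ioo a b ×ˢ Ioo a' b') := by
      rw [h]
      exact ⟨z - l, hz, mkQ_eq_iff.2 (by simpa using hl)⟩
    obtain ⟨y, hy, hyz⟩ := this
    have h1 : z - y ∈ L := mkQ_eq_iff.1 hyz.symm
    have h2 : z - (z - y + l) ∈ interior (Q.rect j) := by
      have := hsub hy
      rw [mem_preimage] at this
      convert this using 1
      abel
    have h3 : z - y + l = l := hunique (L.add_mem h1 hl) hl h2 hz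
    have h4 : z = y := by
      rw [add_eq_right, sub_eq_zero] at h3
      exact h3
    rwa [h4]
  have hne : (Ioo a b ×ˢ Ioo a' b').Nonempty := ⟨z₀, hz₀⟩
  obtain ⟨h1, h2⟩ := (prod_eq_prod_iff_of_nonempty hne).1 heq
  have hl1 := Q.left_lt_right j
  have hl2 := Q.bottom_lt_top j
  obtain ⟨h3, h4⟩ := Ioo_inj hab (by linarith) h1
  obtain ⟨h5, h6⟩ := Ioo_inj hab' (by linarith) h2
  rw [← P.right_sub_left, ← Q.right_sub_left, ← P.top_sub_bottom, ← Q.top_sub_bottom]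
  constructor <;> linarith

end BiPartition

namespace HyperbolicToralAut

variable {L : Submodule ℤ Plane}

/-- Only sizes matter, so the signs of the affine map drop out; what distinguishes `DiagSame` from
`DiagFlip` is the permutation of the two rectangles. -/
theorem diagRel_of_equivalent [DiscreteTopology L] [IsZLattice ℝ L] (D : HyperbolicToralAut L)
    {P Q : BiPartition L} (h : D.Equivalent P Q) : DiagRel P.basis Q.basis := by
  obtain ⟨h, hD, σ, hσ⟩ := h
  obtain ⟨α, β, c, hα, hβ, hform⟩ := exists_affine_of_commute D h hD
  have key : ∀ i, Q.width (σ i) = |α| * P.width i ∧ Q.height (σ i) = |β| * P.height i := by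
    intro i
    apply BiPartition.size_eq_of_image_tile (c := c) hα hβ
    rw [← hσ i, BiPartition.tile, image_image, image_image]
    exact image_congr fun z _ => (hform z).symm
  refine ⟨|α|, |β|, abs_pos.2 hα, abs_pos.2 hβ, ?_⟩
  have hdecomp : ∀ σ : Equiv.Perm (Fin 2), σ = 1 ∨ σ = Equiv.swap 0 1 := by decide
  obtain ⟨h1, h2⟩ := key 0
  obtain ⟨h3, h4⟩ := key 1
  rcases hdecomp σ with rfl | rfl
  · left
    simp only [BiPartition.width, BiPartition.height, Matrix.cons_val_zero, Matrix.cons_val_one,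
      Matrix.cons_val_fin_one, Equiv.Perm.one_apply] at h1 h2 h3 h4
    simp only [DiagSame, BiPartition.basis, diagMap, h1, h2, h3, h4, mul_neg]
  · right
    simp only [BiPartition.width, BiPartition.height, Matrix.cons_val_zero, Matrix.cons_val_one,
      Matrix.cons_val_fin_one, Equiv.swap_apply_left, Equiv.swap_apply_right] at h1 h2 h3 h4
    simp only [DiagFlip, BiPartition.basis, diagMap, h1, h2, h3, h4, neg_mul, mul_neg, neg_neg]

end HyperbolicToralAut

section Converse

variable {L : Submodule ℤ Plane}

/-- `diag(α, β)` as a linear map. -/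
def diagLin (α β : ℝ) : Plane →ₗ[ℤ] Plane where
  toFun := diagMap α β
  map_add' := diagMap_add
  map_smul' a z := by ext <;> simp [diagMap, mul_left_comm]

lemma diagMap_inv_diagMap {α β : ℝ} (hα : α ≠ 0) (hβ : β ≠ 0) (z : Plane) :
    diagMap α⁻¹ β⁻¹ (diagMap α β z) = z := by
  ext
  · exact inv_mul_cancel_left₀ hα _
  · exact inv_mul_cancel_left₀ hβ _

lemma diagMap_diagMap_inv {α β : ℝ} (hα : α ≠ 0) (hβ : β ≠ 0) (z : Plane) :
    diagMap α β (diagMap α⁻¹ β⁻¹ z) = z := by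
  ext
  · exact mul_inv_cancel_left₀ hα _
  · exact mul_inv_cancel_left₀ hβ _

lemma exists_homeomorph_diagMap [DiscreteTopology L] {α β : ℝ} (hα : α ≠ 0) (hβ : β ≠ 0)
    (hL : ∀ z, diagMap α β z ∈ L ↔ z ∈ L) :
    ∃ h : (Plane ⧸ L) ≃ₜ (Plane ⧸ L), ∀ z, h (L.mkQ z) = L.mkQ (diagMap α β z) := by
  have hL' : ∀ z, diagMap α⁻¹ β⁻¹ z ∈ L ↔ z ∈ L := fun z => by
    rw [← hL, diagMap_diagMap_inv hα hβ]
  have hq : Topology.IsQuotientMap L.mkQ :=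
    isCoveringMap_mkQ.isQuotientMap L.mkQ_surjective
  have hcont : ∀ a b : ℝ, Continuous fun z => L.mkQ (diagMap a b z) := fun a b =>
    isCoveringMap_mkQ.continuous.comp (by unfold diagMap; fun_prop)
  let F : (Plane ⧸ L) → (Plane ⧸ L) := L.mapQ L (diagLin α β) fun z hz => (hL z).2 hz
  let G : (Plane ⧸ L) → (Plane ⧸ L) := L.mapQ L (diagLin α⁻¹ β⁻¹) fun z hz => (hL' z).2 hz
  have hF : ∀ z, F (L.mkQ z) = L.mkQ (diagMap α β z) := fun z => rfl
  have hG : ∀ z, G (L.mkQ z) = L.mkQ (diagMap α⁻¹ β⁻¹ z) := fun z => rfl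
  refine ⟨⟨⟨F, G, fun x => ?_, fun x => ?_⟩, ?_, ?_⟩, hF⟩
  · obtain ⟨z, rfl⟩ := L.mkQ_surjective x
    rw [hF, hG, diagMap_inv_diagMap hα hβ]
  · obtain ⟨z, rfl⟩ := L.mkQ_surjective x
    rw [hG, hF, diagMap_diagMap_inv hα hβ]
  · exact hq.continuous_iff.2 (hcont α β)
  · exact hq.continuous_iff.2 (hcont α⁻¹ β⁻¹)

lemma image_mkQ_image {α β : ℝ} (hα : α ≠ 0) (hβ : β ≠ 0) {h : (Plane ⧸ L) ≃ₜ (Plane ⧸ L)}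
    (hh : ∀ z, h (L.mkQ z) = L.mkQ (diagMap α β z)) {S S' : Set Plane}
    (hS : ∀ z, z ∈ S ↔ diagMap α β z ∈ S') : h '' (L.mkQ '' S) = L.mkQ '' S' := by
  ext x
  constructor
  · rintro ⟨_, ⟨z, hz, rfl⟩, rfl⟩
    exact ⟨_, (hS z).1 hz, (hh z).symm⟩
  · rintro ⟨z, hz, rfl⟩
    refine ⟨_, ⟨diagMap α⁻¹ β⁻¹ z, (hS _).2 ?_, rfl⟩, ?_⟩
    · rwa [diagMap_diagMap_inv hα hβ]
    · rw [hh, diagMap_diagMap_inv hα hβ]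

lemma diagSame_mem_iff {α β : ℝ} (hα : 0 < α) (hβ : 0 < β) {b b' : Plane × Plane}
    (hb : b ∈ biFan L) (hb' : b' ∈ biFan L) (h : DiagSame α β b b') (z : Plane) :
    diagMap α β z ∈ L ↔ z ∈ L := by
  subst h
  rw [mem_iff_of_biFan hb (z := z), mem_iff_of_biFan hb']
  refine exists_congr fun m => exists_congr fun n => and_congr ?_ ?_
  · simp only [diagMap]
    exact ⟨fun h => mul_left_cancel₀ hα.ne' (by linear_combination h),
      fun h => by linear_combination α * h⟩
  · simp only [diagMap]
    exact ⟨fun h => mul_left_cancel₀ hβ.ne' (by linear_combination h),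
      fun h => by linear_combination β * h⟩

lemma diagFlip_mem_iff {α β : ℝ} (hα : 0 < α) (hβ : 0 < β) {b b' : Plane × Plane}
    (hb : b ∈ biFan L) (hb' : b' ∈ biFan L) (h : DiagFlip α β b b') (z : Plane) :
    diagMap (-α) β z ∈ L ↔ z ∈ L := by
  subst h
  rw [mem_iff_of_biFan hb (z := z), mem_iff_of_biFan hb', exists_comm]
  refine exists_congr fun m => exists_congr fun n => and_congr ?_ ?_
  · simp only [diagMap]
    exact ⟨fun h => mul_left_cancel₀ hα.ne' (by linear_combination -h),
      fun h => by linear_combination (-α) * h⟩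
  · simp only [diagMap]
    exact ⟨fun h => mul_left_cancel₀ hβ.ne' (by linear_combination h),
      fun h => by linear_combination β * h⟩

namespace HyperbolicToralAut

lemma equivalent_and_isBerg_of_diagMap [DiscreteTopology L] (D : HyperbolicToralAut L)
    {P Q : BiPartition L} {α β : ℝ} (hα : α ≠ 0) (hβ : β ≠ 0)
    (hL : ∀ z, diagMap α β z ∈ L ↔ z ∈ L) (σ : Equiv.Perm (Fin 2))
    (htile : ∀ i z, z ∈ interior (P.rect i) ↔ diagMap α β z ∈ interior (Q.rect (σ i)))
    (hseg : ∀ z, z ∈ P.hSegment ↔ diagMap α β z ∈ Q.hSegment)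
    (vseg : ∀ z, z ∈ P.vSegment ↔ diagMap α β z ∈ Q.vSegment) :
    D.Equivalent P Q ∧ (D.IsBerg Q → D.IsBerg P) := by
  obtain ⟨h, hh⟩ := exists_homeomorph_diagMap hα hβ hL
  have hcomm : ∀ x, h (D.torusMap x) = D.torusMap (h x) := by
    intro x
    obtain ⟨z, rfl⟩ := L.mkQ_surjective x
    rw [D.torusMap_mkQ, hh, hh, D.torusMap_mkQ]
    congr 1
    simp only [diagMap, D.planeMap_apply]
    ext <;> ring
  have himg : ∀ S, h '' (D.torusMap '' S) = D.torusMap '' (h '' S) := fun S => by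
    rw [image_image, image_image]
    exact image_congr fun x _ => hcomm x
  refine ⟨⟨h, hcomm, σ, fun i => image_mkQ_image hα hβ hh (htile i)⟩, fun hQ => ?_⟩
  have h1 : h '' P.horizontalSpine = Q.horizontalSpine := by
    rw [P.horizontalSpine_eq, Q.horizontalSpine_eq, image_mkQ_image hα hβ hh hseg]
  have h2 : h '' P.verticalSpine = Q.verticalSpine := by
    rw [P.verticalSpine_eq, Q.verticalSpine_eq, image_mkQ_image hα hβ hh vseg]
  constructor
  · rw [← image_subset_image_iff h.injective, himg, h1]
    exact hQ.1
  · rw [← image_subset_image_iff h.injective, himg, h2]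
    exact hQ.2

/-- The translation is chosen so that the diagonal map takes the corner of `P` to the corner of `Q`.
It then takes rectangles to rectangles, a reflection exchanging the left and right ones, and it
commutes with `D`, so the Berg property transfers too. -/
theorem exists_equivalent_of_diagRel [DiscreteTopology L] (D : HyperbolicToralAut L)
    {P Q : BiPartition L} (h : DiagRel P.basis Q.basis) :
    ∃ t, D.Equivalent (P.translate t) Q ∧ (D.IsBerg Q → D.IsBerg (P.translate t)) := by
  obtain ⟨α, β, hα, hβ, h | h⟩ := h
  · have hmem := diagSame_mem_iff hα hβ P.basis_mem Q.basis_mem h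
    obtain ⟨P', hP', t, rfl⟩ : ∃ P' : BiPartition L,
        (α * P'.w.1 = Q.w.1 ∧ β * P'.w.2 = Q.w.2) ∧ ∃ t, P' = P.translate t :=
      ⟨P.translate (Q.w.1 / α - P.w.1, Q.w.2 / β - P.w.2), by
        simp only [BiPartition.translate, Prod.fst_add, Prod.snd_add]
        constructor <;> field_simp <;> ring, _, rfl⟩
    refine ⟨t, ?_⟩
    obtain ⟨hw1, hw2⟩ := hP'
    have hu : -Q.u = α * -P.u := congrArg (fun b => b.2.1) h
    have hv : Q.v = α * P.v := congrArg (fun b => b.1.1) h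
    have hp : Q.p = β * P.p := congrArg (fun b => b.1.2) h
    have hq : Q.q = β * P.q := congrArg (fun b => b.2.2) h
    set P' := P.translate t
    change -Q.u = α * -P'.u at hu
    change Q.v = α * P'.v at hv
    change Q.p = β * P'.p at hp
    change Q.q = β * P'.q at hq
    refine D.equivalent_and_isBerg_of_diagMap hα.ne' hβ.ne' hmem (Equiv.refl _) (fun i z => ?_)
      (fun z => ?_) (fun z => ?_)
    · have e1 : Q.left i = α * P'.left i := by
        fin_cases i <;> simp [BiPartition.left] <;> linarith
      have e2 : Q.right i = α * P'.right i := by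
        fin_cases i <;> simp [BiPartition.right] <;> linarith
      have e3 : Q.bottom i = β * P'.bottom i := by
        fin_cases i <;> simp [BiPartition.bottom] <;> linarith
      have e4 : Q.top i = β * P'.top i := by
        fin_cases i <;> simp [BiPartition.top] <;> linarith
      simp only [P'.interior_rect, Q.interior_rect, Equiv.refl_apply, mem_prod, mem_Ioo, diagMap,
        e1, e2, e3, e4, mul_lt_mul_iff_right₀ hα, mul_lt_mul_iff_right₀ hβ]
    · have e1 : Q.w.1 - Q.v = α * (P'.w.1 - P'.v) := by linarith
      have e2 : Q.w.1 + Q.u = α * (P'.w.1 + P'.u) := by linarith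
      simp only [BiPartition.hSegment, mem_prod, mem_Icc, mem_singleton_iff, diagMap, e1, e2, ← hw2,
        mul_le_mul_iff_right₀ hα, mul_right_inj' hβ.ne']
    · have e2 : Q.w.2 + (Q.p + Q.q) = β * (P'.w.2 + (P'.p + P'.q)) := by linarith
      simp only [BiPartition.vSegment, e2]
      simp only [mem_prod, mem_Icc, mem_singleton_iff, diagMap, ← hw2, ← hw1,
        mul_le_mul_iff_right₀ hβ, mul_right_inj' hα.ne']
  · have hmem := diagFlip_mem_iff hα hβ P.basis_mem Q.basis_mem h
    obtain ⟨P', hP', t, rfl⟩ : ∃ P' : BiPartition L,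
        (-α * P'.w.1 = Q.w.1 ∧ β * P'.w.2 = Q.w.2) ∧ ∃ t, P' = P.translate t :=
      ⟨P.translate (-(Q.w.1 / α) - P.w.1, Q.w.2 / β - P.w.2), by
        simp only [BiPartition.translate, Prod.fst_add, Prod.snd_add]
        constructor <;> field_simp <;> ring, _, rfl⟩
    refine ⟨t, ?_⟩
    obtain ⟨hw1, hw2⟩ := hP'
    have hu : -Q.u = -α * P.v := congrArg (fun b => b.2.1) h
    have hv : Q.v = -α * -P.u := congrArg (fun b => b.1.1) h
    have hp : Q.p = β * P.q := congrArg (fun b => b.1.2) h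
    have hq : Q.q = β * P.p := congrArg (fun b => b.2.2) h
    set P' := P.translate t
    change -Q.u = -α * P'.v at hu
    change Q.v = -α * -P'.u at hv
    change Q.p = β * P'.q at hp
    change Q.q = β * P'.p at hq
    have hα' : -α < 0 := neg_neg_of_pos hα
    refine D.equivalent_and_isBerg_of_diagMap hα'.ne hβ.ne' hmem (Equiv.swap 0 1) (fun i z => ?_)
      (fun z => ?_) (fun z => ?_)
    · have e1 : Q.left (Equiv.swap 0 1 i) = -α * P'.right i := by
        fin_cases i <;> simp [BiPartition.left, BiPartition.right] <;> linarith
      have e2 : Q.right (Equiv.swap 0 1 i) = -α * P'.left i := by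
        fin_cases i <;> simp [BiPartition.left, BiPartition.right] <;> linarith
      have e3 : Q.bottom (Equiv.swap 0 1 i) = β * P'.bottom i := by
        fin_cases i <;> simp [BiPartition.bottom] <;> linarith
      have e4 : Q.top (Equiv.swap 0 1 i) = β * P'.top i := by
        fin_cases i <;> simp [BiPartition.top] <;> linarith
      simp only [P'.interior_rect, Q.interior_rect, mem_prod, mem_Ioo, diagMap,
        e1, e2, e3, e4, mul_lt_mul_left_of_neg hα', mul_lt_mul_iff_right₀ hβ]
      rw [and_comm (a := P'.left i < z.1)]
    · have e1 : Q.w.1 - Q.v = -α * (P'.w.1 + P'.u) := by linarith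
      have e2 : Q.w.1 + Q.u = -α * (P'.w.1 - P'.v) := by linarith
      simp only [BiPartition.hSegment, mem_prod, mem_Icc, mem_singleton_iff, diagMap, e1, e2, ← hw2,
        mul_le_mul_left_of_neg hα', mul_right_inj' hβ.ne']
      rw [and_comm (a := _ ≤ z.1)]
    · have e2 : Q.w.2 + (Q.p + Q.q) = β * (P'.w.2 + (P'.p + P'.q)) := by linarith
      simp only [BiPartition.vSegment, e2]
      simp only [mem_prod, mem_Icc, mem_singleton_iff, diagMap, ← hw2, ← hw1,
        mul_le_mul_iff_right₀ hβ, mul_right_inj' hα'.ne]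

end HyperbolicToralAut

end Converse

/-! ### Every basis of the bi-fan carries a Berg partition -/

namespace HyperbolicToralAut

variable {L : Submodule ℤ Plane}

/-- If `D` reverses the orientation, the ratio of the widths is at most `|λ|`. -/
lemma abs_mu_mul_width_le (D : HyperbolicToralAut L) (P : BiPartition L)
    (hneg : D.mu * D.lam < 0) : |D.mu| * P.u ≤ P.v ∧ |D.mu| * P.v ≤ P.u := by
  have hu := P.u_pos
  have hv := P.v_pos
  have hp := P.p_pos
  have hq := P.q_pos
  have hDe := (D.planeMap_mem_iff _).2 (biFan_fst_mem P.basis_mem)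
  have hDf := (D.planeMap_mem_iff _).2 (biFan_snd_mem P.basis_mem)
  -- Orientation is reversed, so the image of `f`, up to sign, falls in the first quadrant and that
  -- of `e` in the second.
  obtain ⟨e', he', he1, he2⟩ : ∃ z ∈ L, z.1 = |D.mu| * P.u ∧ z.2 = |D.lam| * P.q := by
    rcases mul_neg_iff.1 hneg with ⟨h1, h2⟩ | ⟨h1, h2⟩
    · exact ⟨_, L.neg_mem hDf, by simp [planeMap_apply, BiPartition.basis, abs_of_pos h1],
        by simp [planeMap_apply, BiPartition.basis, abs_of_neg h2]⟩
    · exact ⟨_, hDf, by simp [planeMap_apply, BiPartition.basis, abs_of_neg h1],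
        by simp [planeMap_apply, BiPartition.basis, abs_of_pos h2]⟩
  obtain ⟨f', hf', hf1, hf2⟩ : ∃ z ∈ L, z.1 = -(|D.mu| * P.v) ∧ z.2 = |D.lam| * P.p := by
    rcases mul_neg_iff.1 hneg with ⟨h1, h2⟩ | ⟨h1, h2⟩
    · exact ⟨_, L.neg_mem hDe, by simp [planeMap_apply, BiPartition.basis, abs_of_pos h1],
        by simp [planeMap_apply, BiPartition.basis, abs_of_neg h2]⟩
    · exact ⟨_, hDe, by simp [planeMap_apply, BiPartition.basis, abs_of_neg h1],
        by simp [planeMap_apply, BiPartition.basis, abs_of_pos h2]⟩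
  obtain ⟨a, b, ha, hb⟩ := (mem_iff_of_biFan P.basis_mem).1 he'
  obtain ⟨c, d, hc, hd⟩ := (mem_iff_of_biFan P.basis_mem).1 hf'
  rw [he1] at ha
  rw [he2] at hb
  rw [hf1] at hc
  rw [hf2] at hd
  simp only [BiPartition.basis] at ha hb hc hd
  have hm := D.abs_mu_pos
  have hm1 := D.abs_mu_lt_one
  have hml := D.abs_mu_mul_abs_lam
  have hlam : 0 < |D.lam| := abs_pos.2 D.lam_ne_zero
  set m := |D.mu|
  set r := |D.lam|
  have hrq := mul_pos hlam hq
  have hrp := mul_pos hlam hp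
  have hmu' := mul_pos hm hu
  have hmv' := mul_pos hm hv
  have one_le : ∀ k : ℤ, (0 : ℝ) < k → (1 : ℝ) ≤ k := fun k hk => by
    have : 0 < k := by exact_mod_cast hk
    have : 1 ≤ k := by omega
    exact_mod_cast this
  have nonneg : ∀ k : ℤ, ((k : ℝ) ≤ -1 → False) → (0 : ℝ) ≤ k := fun k hk => by
    by_contra! h
    have : k < 0 := by exact_mod_cast h
    have : k ≤ -1 := by omega
    exact hk (by exact_mod_cast this)
  have hb0 : (0 : ℝ) ≤ b := nonneg b fun h => by
    have ha0 : (0 : ℝ) < a := by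
      by_contra! h0
      nlinarith
    nlinarith
  have hc0 : (0 : ℝ) ≤ c := nonneg c fun h => by
    have hd0 : (0 : ℝ) < d := by
      by_contra! h0
      nlinarith
    nlinarith
  have ha1 : (1 : ℝ) ≤ a := one_le a (by
    by_contra! h0
    nlinarith)
  have hd1 : (1 : ℝ) ≤ d := one_le d (by
    by_contra! h0
    nlinarith)
  -- Areas are preserved since `|μ| |λ| = 1`.
  have hdet : (a : ℝ) * d - b * c = 1 := by
    have hpos : 0 < P.v * P.q + P.u * P.p := by positivity
    apply mul_right_cancel₀ hpos.ne'
    have : m * r * (P.u * P.p + P.v * P.q) =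
        (m * P.u) * (r * P.p) - (r * P.q) * (-(m * P.v)) := by ring
    rw [hml, ha, hb, hc, hd] at this
    linear_combination -this
  -- This is the trace relation `|λ| = b + c + |μ|`; it bounds `b + m` and `c + m` by `|λ|`.
  have htr : m * (b + c + m) = 1 := by
    have hpos : 0 < P.u * P.v := by positivity
    apply mul_right_cancel₀ hpos.ne'
    have h1 : (b + m) * P.u = a * P.v := by linarith
    have h2 : (c + m) * P.v = d * P.u := by linarith
    linear_combination P.u * P.v * hdet + (c + m) * P.v * h1 + a * P.v * h2
  constructor
  · have h2 : (c + m) * P.v = d * P.u := by linarith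
    have h3 : m * (c + m) ≤ 1 := by linarith [mul_nonneg hm.le hb0]
    have h4 : m * (d * P.u) ≤ P.v := by
      rw [← h2, ← mul_assoc]
      exact mul_le_of_le_one_left hv.le h3
    exact (mul_le_mul_of_nonneg_left (le_mul_of_one_le_left hu.le hd1) hm.le).trans h4
  · have h2 : (b + m) * P.u = a * P.v := by linarith
    have h3 : m * (b + m) ≤ 1 := by linarith [mul_nonneg hm.le hc0]
    have h4 : m * (a * P.v) ≤ P.u := by
      rw [← h2, ← mul_assoc]
      exact mul_le_of_le_one_left hu.le h3
    exact (mul_le_mul_of_nonneg_left (le_mul_of_one_le_left hv.le ha1) hm.le).trans h4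

/-- With the corner at the fixed point 0, the vertical segment grows upwards and the horizontal one
shrinks in place. If `μ < 0` the latter is also reflected, and the bound on the ratio of the widths
keeps it inside. -/
lemma isBerg_of_pos (D : HyperbolicToralAut L) (P : BiPartition L) (hw : P.w = 0)
    (hlam : 0 < D.lam) : D.IsBerg P := by
  have hu := P.u_pos
  have hv := P.v_pos
  have hp := P.p_pos
  have hq := P.q_pos
  have h1 := D.one_lt_abs_lam
  have hm1 := D.abs_mu_lt_one
  have hm0 := D.abs_mu_pos
  rw [abs_of_pos hlam] at h1
  have hratio := D.abs_mu_mul_width_le P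
  rw [IsBerg, P.horizontalSpine_eq, P.verticalSpine_eq]
  constructor
  · rintro _ ⟨_, ⟨z, ⟨⟨hz1, hz2⟩, hz3⟩, rfl⟩, rfl⟩
    rw [hw] at hz1 hz2 hz3
    simp only [Prod.fst_zero, Prod.snd_zero, zero_sub, zero_add, mem_singleton_iff] at hz1 hz2 hz3
    refine ⟨D.planeMap z, ⟨⟨?_, ?_⟩, ?_⟩, rfl⟩ <;> rw [hw] <;>
      simp only [Prod.fst_zero, Prod.snd_zero, zero_sub, zero_add, mem_singleton_iff,
        planeMap_apply]
    · rcases lt_or_gt_of_ne D.mu_ne_zero with h | h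
      · obtain ⟨h2, h3⟩ := hratio (mul_neg_of_neg_of_pos h hlam)
        rw [abs_of_neg h] at *
        nlinarith
      · rw [abs_of_pos h] at *
        nlinarith
    · rcases lt_or_gt_of_ne D.mu_ne_zero with h | h
      · obtain ⟨h2, h3⟩ := hratio (mul_neg_of_neg_of_pos h hlam)
        rw [abs_of_neg h] at *
        nlinarith
      · rw [abs_of_pos h] at *
        nlinarith
    · rw [hz3, mul_zero]
  · rintro _ ⟨z, ⟨hz1, hz2, hz3⟩, rfl⟩
    rw [hw] at hz1 hz2 hz3
    simp only [Prod.fst_zero, Prod.snd_zero, zero_add, mem_singleton_iff] at hz1 hz2 hz3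
    refine ⟨L.mkQ (0, z.2 / D.lam), ⟨_, ⟨?_, ?_, ?_⟩, rfl⟩, ?_⟩
    · simp [hw]
    · simp only [hw, Prod.snd_zero]
      positivity
    · simp only [hw, Prod.snd_zero, zero_add]
      rw [div_le_iff₀ hlam]
      nlinarith
    · rw [torusMap_mkQ, planeMap_apply]
      congr 1
      ext
      · simp [hz1]
      · simp only
        field_simp

/-- The corner satisfies `λ w₂ = w₂ + p + q`: the bottom of the vertical segment goes to its top,
and the image of the horizontal segment lies at that height. -/
lemma isBerg_of_neg (D : HyperbolicToralAut L) (P : BiPartition L)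
    (hw : P.w = (0, -(P.p + P.q) / (1 - D.lam))) (hlam : D.lam < 0) : D.IsBerg P := by
  have hu := P.u_pos
  have hv := P.v_pos
  have hp := P.p_pos
  have hq := P.q_pos
  have h1 := D.one_lt_abs_lam
  have hm1 := D.abs_mu_lt_one
  have hm0 := D.abs_mu_pos
  rw [abs_of_neg hlam] at h1
  have hratio := D.abs_mu_mul_width_le P
  have hw1 : P.w.1 = 0 := by rw [hw]
  have hw2 : P.w.2 * (1 - D.lam) = -(P.p + P.q) := by
    rw [hw]
    exact div_mul_cancel₀ _ (by linarith)
  rw [IsBerg, P.horizontalSpine_eq, P.verticalSpine_eq]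
  constructor
  · rintro _ ⟨_, ⟨z, ⟨⟨hz1, hz2⟩, hz3⟩, rfl⟩, rfl⟩
    rw [hw1] at hz1 hz2
    rw [mem_singleton_iff] at hz3
    -- Translation by `-(e + f)` lowers the image by `p + q` onto the base. The shift exchanges the
    -- margins of the two ends, so here the bound on the widths is needed when `μ > 0`.
    refine BiPartition.mkQ_mem_image (l := -(P.basis.1 + P.basis.2))
      (L.neg_mem (L.add_mem (biFan_fst_mem P.basis_mem) (biFan_snd_mem P.basis_mem)))
      ⟨⟨?_, ?_⟩, ?_⟩ <;>
      simp only [planeMap_apply, BiPartition.basis, Prod.fst_add, Prod.snd_add, Prod.fst_neg,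
        Prod.snd_neg, hw1, mem_singleton_iff]
    · rcases lt_or_gt_of_ne D.mu_ne_zero with h | h
      · rw [abs_of_neg h] at *
        nlinarith
      · obtain ⟨h2, h3⟩ := hratio (mul_neg_of_pos_of_neg h hlam)
        rw [abs_of_pos h] at *
        nlinarith
    · rcases lt_or_gt_of_ne D.mu_ne_zero with h | h
      · rw [abs_of_neg h] at *
        nlinarith
      · obtain ⟨h2, h3⟩ := hratio (mul_neg_of_pos_of_neg h hlam)
        rw [abs_of_pos h] at *
        nlinarith
    · rw [hz3]
      linarith
  · rintro _ ⟨z, ⟨hz1, hz2, hz3⟩, rfl⟩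
    rw [hw1, mem_singleton_iff] at hz1
    refine ⟨L.mkQ (0, z.2 / D.lam), ⟨_, ⟨?_, ?_, ?_⟩, rfl⟩, ?_⟩
    · simp [hw1]
    · simp only
      rw [le_div_iff_of_neg hlam]
      linarith
    · simp only
      rw [div_le_iff_of_neg hlam]
      nlinarith
    · rw [torusMap_mkQ, planeMap_apply]
      congr 1
      ext
      · simp [hz1]
      · simp only
        have := hlam.ne
        field_simp

theorem exists_isBerg (D : HyperbolicToralAut L) {b : Plane × Plane} (hb : b ∈ biFan L) :
    ∃ P : BiPartition L, P.basis = b ∧ D.IsBerg P := by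
  obtain ⟨h1, h2, h3, h4, h5⟩ := hb
  let P : Plane → BiPartition L := fun w =>
    { u := -b.2.1, v := b.1.1, p := b.1.2, q := b.2.2, w := w, u_pos := neg_pos.2 h3, v_pos := h1
      p_pos := h2, q_pos := h4, span_eq := by rw [neg_neg]; exact h5 }
  have hP : ∀ w, (P w).basis = b := fun w => by simp [P, BiPartition.basis]
  rcases lt_or_gt_of_ne D.lam_ne_zero with h | h
  · exact ⟨P (0, -(b.1.2 + b.2.2) / (1 - D.lam)), hP _, D.isBerg_of_neg _ rfl h⟩
  · exact ⟨P 0, hP _, D.isBerg_of_pos _ rfl h⟩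

end HyperbolicToralAut

/-! ### The connectivity matrix of a Berg partition -/

namespace HyperbolicToralAut

variable {L : Submodule ℤ Plane}

lemma torusMap_injective (D : HyperbolicToralAut L) : Function.Injective D.torusMap := by
  intro x y h
  obtain ⟨z, rfl⟩ := L.mkQ_surjective x
  obtain ⟨w, rfl⟩ := L.mkQ_surjective y
  rw [torusMap_mkQ, torusMap_mkQ, mkQ_eq_iff, ← map_sub, D.planeMap_mem_iff] at h
  exact mkQ_eq_iff.2 h

/-- The lattice vectors `l` such that the interior of `R_j + l` meets the interior of the image
of `R_i`. -/
def crossings (D : HyperbolicToralAut L) (P : BiPartition L) (i j : Fin 2) : Set Plane :=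
  {l : Plane | l ∈ L ∧ ((D.planeMap '' interior (P.rect i)) ∩
    ((fun z => z + l) '' interior (P.rect j))).Nonempty}

lemma countable_lattice {b : Plane × Plane} (hb : b ∈ biFan L) : (L : Set Plane).Countable := by
  refine (countable_range fun k : ℤ × ℤ =>
    ((k.1 * b.1.1 + k.2 * b.2.1, k.1 * b.1.2 + k.2 * b.2.2) : Plane)).mono fun z hz => ?_
  obtain ⟨m, n, h1, h2⟩ := (mem_iff_of_biFan hb).1 hz
  exact ⟨(m, n), Prod.ext h1.symm h2.symm⟩

/-- The image of a rectangle of a Berg partition crosses every rectangle that it meets from bottom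
to top, inside its vertical sides. -/
lemma exists_image_box (D : HyperbolicToralAut L) {P : BiPartition L} (hP : D.IsBerg P)
    (i : Fin 2) : ∃ a b a' b' : ℝ, a < b ∧ a' < b' ∧ b' - a' = |D.lam| * P.height i ∧
      D.planeMap '' interior (P.rect i) = Ioo a b ×ˢ Ioo a' b' ∧
      ∀ j, ∀ l ∈ D.crossings P i j, P.left j + l.1 ≤ a ∧ b ≤ P.right j + l.1 ∧
        a' ≤ P.bottom j + l.2 ∧ P.top j + l.2 ≤ b' := by
  obtain ⟨a, b, hab, hw, hI, -, -⟩ := image_affine_Ioo D.mu_ne_zero 0 (P.left_lt_right i)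
  obtain ⟨a', b', hab', hw', hI', ha', hb'⟩ :=
    image_affine_Ioo D.lam_ne_zero 0 (P.bottom_lt_top i)
  simp only [add_zero] at hI hI' ha' hb'
  have himg : D.planeMap '' interior (P.rect i) = Ioo a b ×ˢ Ioo a' b' := by
    rw [P.interior_rect, ← hI, ← hI', prod_image_image_eq]
    rfl
  -- Because `Jᵘ ⊆ D(Jᵘ)` and `D` is injective, a point of `Jᵘ` in the image would come from a point
  -- of `Jᵘ` interior to a rectangle.
  have hvert : ∀ z ∈ Ioo a b ×ˢ Ioo a' b', L.mkQ z ∉ P.verticalSpine := by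
    intro z hz hmem
    rw [← himg] at hz
    obtain ⟨y, hy, rfl⟩ := hz
    obtain ⟨x, hx, hxy⟩ := hP.2 hmem
    rw [← torusMap_mkQ] at hxy
    rw [D.torusMap_injective hxy] at hx
    exact P.mkQ_notMem_verticalSpine hy hx
  have hhor : ∀ x ∈ Ioo a b, ∀ y, (y = a' ∨ y = b') → L.mkQ (x, y) ∈ P.horizontalSpine := by
    intro x hx y hy
    rw [← hI] at hx
    obtain ⟨x', hx', rfl⟩ := hx
    obtain ⟨y', hy', rfl⟩ : ∃ y', (y' = P.bottom i ∨ y' = P.top i) ∧ D.lam * y' = y := by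
      rcases hy with rfl | rfl
      · exact ha'.elim (fun h => ⟨_, Or.inl rfl, h.symm⟩) (fun h => ⟨_, Or.inr rfl, h.symm⟩)
      · exact hb'.elim (fun h => ⟨_, Or.inl rfl, h.symm⟩) (fun h => ⟨_, Or.inr rfl, h.symm⟩)
    refine hP.1 ⟨L.mkQ (x', y'), ⟨(x', y'), mem_iUnion.2 ⟨i, ⟨hx'.1.le, hx'.2.le⟩, hy'⟩, rfl⟩, rfl⟩
  refine ⟨a, b, a', b', hab, hab', by rw [hw', P.top_sub_bottom], himg, ?_⟩
  rintro j l ⟨hl, z, hz, y, hy, rfl⟩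
  rw [himg] at hz
  have hy0 := hy
  rw [P.interior_rect] at hy
  obtain ⟨⟨h1, h2⟩, h3, h4⟩ := hy
  obtain ⟨⟨k1, k2⟩, k3, k4⟩ := hz
  simp only [Prod.fst_add, Prod.snd_add] at k1 k2 k3 k4
  have hside : ∀ x, (x = P.left j ∨ x = P.right j) → a < x + l.1 → x + l.1 < b → False := by
    intro x hx hax hxb
    refine hvert (x + l.1, y.2 + l.2) ⟨⟨hax, hxb⟩, k3, k4⟩ ⟨(x, y.2), ?_, ?_⟩
    · exact mem_iUnion.2 ⟨j, hx, h3.le, h4.le⟩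
    · rw [mkQ_eq_iff, ← L.neg_mem_iff]
      convert hl using 1
      ext <;> simp
  have hend : ∀ t, (t = a' ∨ t = b') → P.bottom j < t - l.2 → t - l.2 < P.top j → False := by
    intro t ht hbt htt
    have h5 : L.mkQ (y.1, t - l.2) = L.mkQ (y.1 + l.1, t) := by
      rw [mkQ_eq_iff, ← L.neg_mem_iff]
      convert hl using 1
      ext <;> simp
    refine P.mkQ_notMem_horizontalSpine (i := j) (z := (y.1, t - l.2)) ?_
      (h5 ▸ hhor _ ⟨k1, k2⟩ t ht)
    rw [P.interior_rect]
    exact ⟨⟨h1, h2⟩, hbt, htt⟩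
  refine ⟨?_, ?_, ?_, ?_⟩ <;> by_contra! h
  · exact hside _ (Or.inl rfl) h (by linarith)
  · exact hside _ (Or.inr rfl) (by linarith) h
  · exact hend _ (Or.inl rfl) (by linarith) (by linarith)
  · exact hend _ (Or.inr rfl) (by linarith) (by linarith)

open MeasureTheory in
/-- The heights of the rectangles of a Berg partition form an eigenvector of the matrix that counts
crossings. -/
theorem abs_lam_mul_height (D : HyperbolicToralAut L) {P : BiPartition L} (hP : D.IsBerg P)
    (i : Fin 2) : |D.lam| * P.height i = ∑ j, ((D.crossings P i j).ncard : ℝ) * P.height j := by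
  obtain ⟨a, b, a', b', hab, hab', hlen, himg, hcross⟩ := D.exists_image_box hP i
  -- The tiles cut a vertical line through the image box into segments of lengths `P.height j`, one
  -- for each crossing; comparing total lengths gives the equation.
  obtain ⟨x₀, hx1, hx2⟩ := exists_between hab
  have hmem : ∀ j, ∀ l ∈ D.crossings P i j, ∀ y ∈ Ico (P.bottom j + l.2) (P.top j + l.2),
      ((x₀, y) : Plane) - l ∈ P.halfOpen j := by
    intro j l hl y hy
    obtain ⟨h1, h2, -, -⟩ := hcross j l hl
    refine ⟨⟨?_, ?_⟩, ?_, ?_⟩ <;> simp only [Prod.fst_sub, Prod.snd_sub]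
    · linarith
    · linarith
    · linarith [hy.1]
    · linarith [hy.2]
  let f : (Σ j, D.crossings P i j) → Set ℝ := fun s =>
    Ico (P.bottom s.1 + s.2.1.2) (P.top s.1 + s.2.1.2)
  have hunion : Ico a' b' = ⋃ s, f s := by
    apply Subset.antisymm
    · rintro y ⟨hy1, hy2⟩
      obtain ⟨j, l, hl, ⟨h1, h2⟩, h3, h4⟩ := P.exists_halfOpen (x₀, y)
      simp only [Prod.fst_sub, Prod.snd_sub] at h1 h2 h3 h4
      -- A small move to the right and up carries a point of a half-open tile into the interiors of
      -- both the tile and the image.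
      obtain ⟨x, hx, hx'⟩ := exists_between (lt_min hx2 (show x₀ < P.right j + l.1 by linarith))
      obtain ⟨t, ht, ht'⟩ := exists_between (lt_min hy2 (show y < P.top j + l.2 by linarith))
      rw [lt_min_iff] at hx' ht'
      have hl' : l ∈ D.crossings P i j := by
        refine ⟨hl, (x, t), ?_, (x, t) - l, ?_, sub_add_cancel _ _⟩
        · rw [himg]
          exact ⟨⟨by simp only; linarith, hx'.1⟩, by simp only; linarith, ht'.1⟩
        · rw [P.interior_rect]
          refine ⟨⟨?_, ?_⟩, ?_, ?_⟩ <;> simp only [Prod.fst_sub, Prod.snd_sub] <;> linarith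
      exact mem_iUnion.2 ⟨⟨j, l, hl'⟩, by simp only; linarith, by simp only; linarith⟩
    · refine iUnion_subset fun s => ?_
      obtain ⟨-, -, h3, h4⟩ := hcross s.1 s.2.1 s.2.2
      exact Ico_subset_Ico h3 h4
  have hdisj : Pairwise (Function.onFun Disjoint f) := by
    rintro ⟨j, l, hl⟩ ⟨j', l', hl'⟩ hne
    rw [Function.onFun, disjoint_left]
    intro y hy hy'
    obtain ⟨rfl, rfl⟩ := P.halfOpen_unique hl.1 hl'.1 (hmem j l hl y hy) (hmem j' l' hl' y hy')
    exact hne rfl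
  have hcount : ∀ j, Countable (D.crossings P i j) := fun j =>
    ((countable_lattice P.basis_mem).mono fun l hl => hl.1).to_subtype
  -- The count is made with `encard` in `ENNReal`: finiteness is only deduced from it, and `ncard`
  -- of an infinite set would be 0.
  have hvol : ENNReal.ofReal (b' - a') =
      ∑ j, ((D.crossings P i j).encard : ENNReal) * ENNReal.ofReal (P.height j) := by
    rw [← Real.volume_Ico, hunion, measure_iUnion hdisj fun s => measurableSet_Ico,
      ENNReal.tsum_sigma', tsum_fintype]
    refine Finset.sum_congr rfl fun j _ => ?_
    simp only [f, Real.volume_Ico, add_sub_add_right_eq_sub, P.top_sub_bottom]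
    rw [ENNReal.tsum_const]
    rfl
  have hfin : ∀ j, (D.crossings P i j).Finite := by
    intro j
    rw [← encard_ne_top_iff]
    intro htop
    have h1 : ((D.crossings P i j).encard : ENNReal) * ENNReal.ofReal (P.height j) ≤
        ENNReal.ofReal (b' - a') := by
      rw [hvol]
      exact Finset.single_le_sum (f := fun j =>
        ((D.crossings P i j).encard : ENNReal) * ENNReal.ofReal (P.height j))
        (fun _ _ => zero_le) (Finset.mem_univ j)
    rw [htop, ENat.toENNReal_top, ENNReal.top_mul
      (ENNReal.ofReal_pos.2 (P.height_pos j)).ne'] at h1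
    exact ENNReal.ofReal_ne_top (top_le_iff.1 h1)
  rw [← hlen]
  have hnn : ∀ j, 0 ≤ ((D.crossings P i j).ncard : ℝ) * P.height j := fun j =>
    mul_nonneg (Nat.cast_nonneg _) (P.height_pos j).le
  rw [← ENNReal.ofReal_eq_ofReal_iff (by linarith) (Finset.sum_nonneg fun j _ => hnn j), hvol,
    ENNReal.ofReal_sum_of_nonneg fun j _ => hnn j]
  refine Finset.sum_congr rfl fun j _ => ?_
  rw [ENNReal.ofReal_mul (Nat.cast_nonneg _), ENNReal.ofReal_natCast, ← (hfin j).cast_ncard_eq]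
  rfl

/-- If `λ` were an integer `k`, then `D e - k e` would be a lattice vector on the horizontal axis,
hence 0, giving `μ = λ`. -/
lemma abs_lam_ne_natCast (D : HyperbolicToralAut L) (hL : AxisFree L) {b : Plane × Plane}
    (hb : b ∈ biFan L) (n : ℕ) : |D.lam| ≠ n := by
  intro h
  obtain ⟨k, hk⟩ : ∃ k : ℤ, D.lam = k := by
    rcases abs_eq_abs.1 (h.trans (Nat.abs_cast n).symm) with h | h
    · exact ⟨n, by exact_mod_cast h⟩
    · exact ⟨-n, by exact_mod_cast h⟩
  have hmem : D.planeMap b.1 - k • b.1 ∈ L :=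
    L.sub_mem ((D.planeMap_mem_iff _).2 (biFan_fst_mem hb)) (L.smul_mem _ (biFan_fst_mem hb))
  have h0 := hL.2 _ hmem (by
    rw [Prod.snd_sub, Prod.smul_snd, zsmul_eq_mul, planeMap_apply, hk, sub_self])
  have h1 := congrArg Prod.fst h0
  rw [Prod.fst_sub, Prod.smul_fst, zsmul_eq_mul, planeMap_apply, ← hk, Prod.fst_zero] at h1
  exact D.mu_ne_lam (mul_right_cancel₀ hb.1.ne' (sub_eq_zero.1 h1))

/-- Bases of the bi-fan whose vertical coordinates are proportional are related by a diagonal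
map. -/
lemma diagRel_of_heights (D : HyperbolicToralAut L) (hL : AxisFree L) {b b' : Plane × Plane}
    (hb : b ∈ biFan L) (hb' : b' ∈ biFan L) {β : ℝ} (hβ : 0 < β)
    (h : (b'.1.2 = β * b.1.2 ∧ b'.2.2 = β * b.2.2) ∨
      (b'.2.2 = β * b.1.2 ∧ b'.1.2 = β * b.2.2)) : DiagRel b b' := by
  obtain ⟨m, n, hn, h1, h2⟩ := D.exists_coeff hb
  -- The vector `D z - m z - n w` has height 0, so it vanishes; its abscissa gives the relation.
  have key : ∀ z w : Plane, z ∈ L → w ∈ L → z.2 = β * b.1.2 → w.2 = β * b.2.2 →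
      D.mu * z.1 = m * z.1 + n * w.1 := by
    intro z w hz hw hz2 hw2
    have hmem : D.planeMap z - (m • z + n • w) ∈ L :=
      L.sub_mem ((D.planeMap_mem_iff _).2 hz) (L.add_mem (L.smul_mem _ hz) (L.smul_mem _ hw))
    have h0 := hL.2 _ hmem (by
      rw [Prod.snd_sub, Prod.snd_add, Prod.smul_snd, Prod.smul_snd, zsmul_eq_mul, zsmul_eq_mul,
        planeMap_apply, hz2, hw2]
      linear_combination β * h2)
    have h3 := congrArg Prod.fst h0
    rw [Prod.fst_sub, Prod.fst_add, Prod.smul_fst, Prod.smul_fst, zsmul_eq_mul, zsmul_eq_mul,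
      planeMap_apply, Prod.fst_zero] at h3
    linear_combination h3
  rcases h with ⟨h3, h4⟩ | ⟨h3, h4⟩
  · refine ⟨b'.1.1 / b.1.1, β, div_pos hb'.1 hb.1, hβ, Or.inl ?_⟩
    exact Prod.ext (Prod.ext (div_mul_cancel₀ _ hb.1.ne').symm h3) (Prod.ext
      (eq_div_mul_of_relation hn hb.1.ne' h1
        (key _ _ (biFan_fst_mem hb') (biFan_snd_mem hb') h3 h4)) h4)
  · refine ⟨-(b'.2.1 / b.1.1), β, neg_pos.2 (div_neg_of_neg_of_pos hb'.2.2.1 hb.1), hβ, Or.inr ?_⟩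
    rw [DiagFlip, neg_neg]
    exact Prod.ext (Prod.ext (eq_div_mul_of_relation hn hb.1.ne' h1
      (key _ _ (biFan_snd_mem hb') (biFan_fst_mem hb') h3 h4)) h4)
      (Prod.ext (div_mul_cancel₀ _ hb.1.ne').symm h3)

/-- One row of the eigenvector equation suffices: `(|λ| - c₀₀) h₀ = c₀₁ h₁` fixes the ratio of the
heights because `|λ| ≠ c₀₀`. The orderings `σ` and `τ` matter only through `τ * σ⁻¹`. -/
theorem diagRel_of_sameConnectivity (D : HyperbolicToralAut L) (hL : AxisFree L)
    {P Q : BiPartition L} (hP : D.IsBerg P) (hQ : D.IsBerg Q) (h : D.SameConnectivity P Q) :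
    DiagRel P.basis Q.basis := by
  obtain ⟨σ, τ, h⟩ := h
  have hc : ∀ i j, (D.crossings P (σ i) (σ j)).ncard = (D.crossings Q (τ i) (τ j)).ncard :=
    fun i j => congrFun (congrFun h i) j
  have hPe := D.abs_lam_mul_height hP (σ 0)
  have hQe := D.abs_lam_mul_height hQ (τ 0)
  rw [← Equiv.sum_comp σ, Fin.sum_univ_two] at hPe
  rw [← Equiv.sum_comp τ, Fin.sum_univ_two, ← hc, ← hc] at hQe
  have hne := sub_ne_zero.2
    (D.abs_lam_ne_natCast hL P.basis_mem (D.crossings P (σ 0) (σ 0)).ncard)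
  have hprop : P.height (σ 0) * Q.height (τ 1) = Q.height (τ 0) * P.height (σ 1) := by
    apply mul_left_cancel₀ hne
    linear_combination Q.height (τ 1) * hPe - P.height (σ 1) * hQe
  have hpos := P.height_pos (σ 0)
  have hβ : 0 < Q.height (τ 0) / P.height (σ 0) := div_pos (Q.height_pos _) hpos
  have hall : ∀ i, Q.height (τ i) = Q.height (τ 0) / P.height (σ 0) * P.height (σ i) := by
    intro i
    rw [div_mul_eq_mul_div, eq_div_iff hpos.ne']
    fin_cases i
    · rfl
    · simp only [Fin.mk_one]
      linarith
  set β := Q.height (τ 0) / P.height (σ 0)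
  have hall' : ∀ i, Q.height ((τ * σ⁻¹) i) = β * P.height i := fun i => by
    rw [Equiv.Perm.mul_apply, hall, Equiv.Perm.inv_def, Equiv.apply_symm_apply]
  have hdecomp : ∀ ρ : Equiv.Perm (Fin 2), ρ = 1 ∨ ρ = Equiv.swap 0 1 := by decide
  apply D.diagRel_of_heights hL P.basis_mem Q.basis_mem hβ
  rcases hdecomp (τ * σ⁻¹) with hρ | hρ <;> rw [hρ] at hall'
  · exact Or.inl ⟨hall' 0, hall' 1⟩
  · exact Or.inr ⟨hall' 0, hall' 1⟩

end HyperbolicToralAut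

end

/-! ### Assembly of the two statements -/

theorem mainTheorem4 (L : Submodule ℤ Plane) [DiscreteTopology L] [IsZLattice ℝ L]
    (D : HyperbolicToralAut L) :
    (∀ P Q : BiPartition L, D.IsBerg P → D.IsBerg Q → D.SameConnectivity P Q →
      ∃ t : Plane, D.IsBerg (P.translate t) ∧ D.Equivalent (P.translate t) Q) ∧
    (biFan L).Nonempty ∧
    ∀ b ∈ biFan L, ∃ N : ℕ, IsBasicSemiPeriodOrPeriod (cuttingSeq b) N ∧
      ∃ S : Fin N → BiPartition L, (∀ i, D.IsBerg (S i)) ∧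
        ∀ Q : BiPartition L, D.IsBerg Q → ∃! i, D.SameShape (S i) Q := by
  have hL := D.axisFree
  refine ⟨fun P Q hP hQ h => ?_, biFan_nonempty D, fun b hb => ?_⟩
  · obtain ⟨t, h1, h2⟩ :=
      D.exists_equivalent_of_diagRel (D.diagRel_of_sameConnectivity hL hP hQ h)
    exact ⟨t, h2 hQ, h1⟩
  · obtain ⟨N, hN⟩ := exists_isBasicSemiPeriodOrPeriod D hL hb
    -- The representatives are Berg partitions over `N` consecutive bases of the cutting orbit, one
    -- for each coset of `shiftGroup`.
    choose S hS hBerg using fun i : Fin N => D.exists_isBerg (cutBasis_mem hL hb (i : ℕ))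
    refine ⟨N, hN, S, hBerg, fun Q _ => ?_⟩
    obtain ⟨n, hn⟩ := exists_cutBasis_eq hL hb Q.basis_mem
    have hiff : ∀ i, D.SameShape (S i) Q ↔ n - (i : ℕ) ∈ shiftGroup (cuttingSeq b) := by
      intro i
      rw [← diagRel_cutBasis_iff D hL hb, ← hn, ← hS i]
      constructor
      · rintro ⟨t, ht⟩
        have h := D.diagRel_of_equivalent ht
        exact h
      · intro h
        obtain ⟨t, ht, -⟩ := D.exists_equivalent_of_diagRel h
        exact ⟨t, ht⟩
    simp only [hiff]
    exact existsUnique_sub_mem_shiftGroup hN n
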